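/- For a coloring $f:\mathbb N\to k=\{0,\dots,k-1\}$ with $k\in\mathbb N$, call $b\in\mathbb N$ a \emph{bound} for $f$ if for every $x\ge b$ there is a $y\ge b$ with $y\ne x$ and $f(y)=f(x)$. Let $\mathsf{ERT}$ be the principle "for every $k$ and every $f:\mathbb N\to k$ there is a bound for $f$", and let $\mathsf{minERT}$ be the principle "for every $k$ and every $f:\mathbb N\to k$ there is a least bound for $f$". Considered as Weihrauch problems (subsets of $\mathbb N^{\mathbb N}\times\mathbb N$), both take as instance a pair $(k,f)$ with $f:\mathbb N\to k$; the solutions of $\mathsf{ERT}$ are all bounds for $f$, and the only solution of $\mathsf{minERT}$ is the least bound for $f$. For problems $P,Q$ write $P\le_{\mathrm W}Q$ if there are partial computable functionals $\Phi,\Psi$ such that for every $I\in\operatorname{dom}(P)$ we have $\Phi(I)\in\operatorname{dom}(Q)$, and $(I,\Psi(I,S))\in P$ for every $S$ with $(\Phi(I),S)\in Q$; write $P\equiv_{\mathrm W}Q$ if $P\le_{\mathrm W}Q$ and $Q\le_{\mathrm W}P$. Let $\mathsf{RCA}_0^*$ be the theory in the language of second order arithmetic with exponentiation whose axioms are the basic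 arithmetic axioms, the axioms $m^0=1$ and $m^{n+1}=m^n\cdot m$, induction for $\Sigma^0_0$ formulas, and comprehension for $\Delta^0_1$ formulas (functions are coded as sets of ordered pairs). \textbf{Theorem.} $\mathsf{ERT}\equiv_{\mathrm W}\mathsf{minERT}$. Moreover, $\mathsf{RCA}_0^*$ proves $\mathsf{ERT}\leftrightarrow\mathsf{minERT}$. -/

import Mathlib

/-! ### Weihrauch problems and Weihrauch reducibility -/

namespace Weihrauch

/-- The partial computable functionals `Φ(p; n)`, with oracle `p : ℕ → ℕ` and numerical input `n`,
computed uniformly in the oracle: the least class containing the basic functions and the oracle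
call, and closed under pairing, composition, primitive recursion and unbounded search.  The clauses
are those of `Nat.RecursiveIn`, with the oracle as an argument. -/
inductive ComputableFunctional : ((ℕ → ℕ) → ℕ →. ℕ) → Prop
  | zero : ComputableFunctional fun _ _ => Part.some 0
  | succ : ComputableFunctional fun _ n => Part.some (n + 1)
  | left : ComputableFunctional fun _ n => Part.some n.unpair.1
  | right : ComputableFunctional fun _ n => Part.some n.unpair.2
  | oracle : ComputableFunctional fun p n => Part.some (p n)
  | pair {Φ Ψ : (ℕ → ℕ) → ℕ →. ℕ} (hΦ : ComputableFunctional Φ) (hΨ : ComputableFunctional Ψ) :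
      ComputableFunctional fun p n => Nat.pair <$> Φ p n <*> Ψ p n
  | comp {Φ Ψ : (ℕ → ℕ) → ℕ →. ℕ} (hΦ : ComputableFunctional Φ) (hΨ : ComputableFunctional Ψ) :
      ComputableFunctional fun p n => Ψ p n >>= Φ p
  | prec {Φ Ψ : (ℕ → ℕ) → ℕ →. ℕ} (hΦ : ComputableFunctional Φ) (hΨ : ComputableFunctional Ψ) :
      ComputableFunctional fun p a =>
        a.unpair.2.rec (Φ p a.unpair.1) fun y IH => do
          let i ← IH
          Ψ p (Nat.pair a.unpair.1 (Nat.pair y i))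
  | rfind {Φ : (ℕ → ℕ) → ℕ →. ℕ} (hΦ : ComputableFunctional Φ) :
      ComputableFunctional fun p a =>
        Nat.rfind fun n => (fun m => decide (m = 0)) <$> Φ p (Nat.pair a n)

/-- A Weihrauch problem: a set of pairs (instance, solution). -/
abbrev Problem : Type := Set ((ℕ → ℕ) × ℕ)

/-- The instances of a problem. -/
def Problem.domain (P : Problem) : Set (ℕ → ℕ) := {I | ∃ S, (I, S) ∈ P}

/-- `P ≤_W Q`: an instance `I` of `P` is uniformly computably transformed into an instance
`J = Φ(I)` of `Q`, and every solution `S` of `J` is uniformly computably transformed, with the help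
of `I`, into a solution `T = Ψ(I, S)` of `I`. -/
def Reducible (P Q : Problem) : Prop :=
  ∃ Φ Ψ : (ℕ → ℕ) → ℕ →. ℕ, ComputableFunctional Φ ∧ ComputableFunctional Ψ ∧
    ∀ I ∈ P.domain, ∃ J ∈ Q.domain, (∀ n, J n ∈ Φ I n) ∧
      ∀ S, (J, S) ∈ Q → ∃ T ∈ Ψ I S, (I, T) ∈ P

/-- `P ≡_W Q`. -/
def Equivalent (P Q : Problem) : Prop := Reducible P Q ∧ Reducible Q P

/-- `b` is a bound for the coloring `f`: every color that appears at or after `b` appears at least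
twice at or after `b`. -/
def IsBound (f : ℕ → ℕ) (b : ℕ) : Prop := ∀ x ≥ b, ∃ y ≥ b, x ≠ y ∧ f x = f y

/-- `p` codes the pair of a number `k = p 0` and a coloring `f : ℕ → {0, …, k - 1}`,
`f n = p (n + 1)`. -/
def IsInstance (p : ℕ → ℕ) : Prop := ∀ n, p (n + 1) < p 0

/-- The Weihrauch problem `ERT`: given `k` and `f : ℕ → k`, output a bound for `f`. -/
def ERT : Problem := {q | IsInstance q.1 ∧ IsBound (fun n => q.1 (n + 1)) q.2}

/-- The Weihrauch problem `minERT`: given `k` and `f : ℕ → k`, output the least bound for `f`. -/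
def minERT : Problem :=
  {q | IsInstance q.1 ∧ IsLeast {b | IsBound (fun n => q.1 (n + 1)) b} q.2}

end Weihrauch

/-! ### Second order arithmetic with exponentiation, and the theory `RCA₀*` -/

namespace SecondOrder

/-- Number terms.  Variables are de Bruijn indices. -/
inductive Term : Type
  | var (i : ℕ) : Term
  | zero : Term
  | one : Term
  | add (s t : Term) : Term
  | mul (s t : Term) : Term
  | exp (s t : Term) : Term

/-- Simultaneous substitution in a term. -/
def Term.subst (σ : ℕ → Term) : Term → Term
  | .var i => σ i
  | .zero => .zero
  | .one => .one
  | .add s t => .add (s.subst σ) (t.subst σ)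
  | .mul s t => .mul (s.subst σ) (t.subst σ)
  | .exp s t => .exp (s.subst σ) (t.subst σ)

/-- Make room for one new number variable. -/
def Term.shift (t : Term) : Term := t.subst fun i => .var (i + 1)

/-- The formulas of second order arithmetic with exponentiation.  Number variables and set
variables are two separate families of de Bruijn indices; `all` binds number variable `0` and
`allSet` binds set variable `0`.  The logic is classical, and the other connectives and
quantifiers are the usual abbreviations below. -/
inductive Formula : Type
  | falsum : Formula
  | eq (s t : Term) : Formula
  | lt (s t : Term) : Formula
  | mem (t : Term) (X : ℕ) : Formula
  | imp (φ ψ : Formula) : Formula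
  | all (φ : Formula) : Formula
  | allSet (φ : Formula) : Formula

/-- Extend a substitution by a term for variable `0`; the other variables move down by one. -/
def consTerm (t : Term) (σ : ℕ → Term) : ℕ → Term
  | 0 => t
  | i + 1 => σ i

/-- The same for set variables. -/
def consSet (Y : ℕ) (ρ : ℕ → ℕ) : ℕ → ℕ
  | 0 => Y
  | i + 1 => ρ i

namespace Formula

/-- Simultaneous capture-avoiding substitution of terms for number variables and of set variables
for set variables. -/
def subst : (ℕ → Term) → (ℕ → ℕ) → Formula → Formula
  | _, _, falsum => falsum
  | σ, _, eq s t => eq (s.subst σ) (t.subst σ)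
  | σ, _, lt s t => lt (s.subst σ) (t.subst σ)
  | σ, ρ, mem t X => mem (t.subst σ) (ρ X)
  | σ, ρ, imp φ ψ => imp (subst σ ρ φ) (subst σ ρ ψ)
  | σ, ρ, all φ => all (subst (consTerm (.var 0) fun i => (σ i).shift) ρ φ)
  | σ, ρ, allSet φ => allSet (subst σ (consSet 0 fun i => ρ i + 1) φ)

/-- Make room for one new number variable. -/
def shift (φ : Formula) : Formula := φ.subst (fun i => .var (i + 1)) id

/-- Make room for one new set variable. -/
def shiftSet (φ : Formula) : Formula := φ.subst .var fun i => i + 1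

/-- `φ(t)`: put `t` for number variable `0`, which disappears. -/
def inst (t : Term) (φ : Formula) : Formula := φ.subst (consTerm t .var) id

/-- `φ(Y)`: put `Y` for set variable `0`, which disappears. -/
def instSet (Y : ℕ) (φ : Formula) : Formula := φ.subst .var (consSet Y id)

/-- `φ(n + 1)`, for `n` the number variable `0`, which stays. -/
def instSucc (φ : Formula) : Formula :=
  φ.subst (consTerm (.add (.var 0) .one) fun i => .var (i + 1)) id

/-- Negation. -/
def neg (φ : Formula) : Formula := imp φ falsum
/-- Conjunction. -/
def and (φ ψ : Formula) : Formula := neg (imp φ (neg ψ))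
/-- Disjunction. -/
def or (φ ψ : Formula) : Formula := imp (neg φ) ψ
/-- Biconditional. -/
def iff (φ ψ : Formula) : Formula := and (imp φ ψ) (imp ψ φ)
/-- Existential number quantifier. -/
def ex (φ : Formula) : Formula := neg (all (neg φ))
/-- Existential set quantifier. -/
def exSet (φ : Formula) : Formula := neg (allSet (neg φ))
/-- `s ≤ t`. -/
def le (s t : Term) : Formula := or (lt s t) (eq s t)

/-- `Σ⁰₀` formulas: built from atomic formulas by propositional connectives and bounded number
quantifiers `∀ n < t`, where `n` does not occur in `t` (`∃ n < t, φ` is `¬ ∀ n < t, ¬ φ`).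
Free number and set variables are allowed. -/
inductive IsSigma00 : Formula → Prop
  | falsum : IsSigma00 falsum
  | eq (s t : Term) : IsSigma00 (eq s t)
  | lt (s t : Term) : IsSigma00 (lt s t)
  | mem (t : Term) (X : ℕ) : IsSigma00 (mem t X)
  | imp {φ ψ : Formula} (hφ : IsSigma00 φ) (hψ : IsSigma00 ψ) : IsSigma00 (imp φ ψ)
  | ball (t : Term) {φ : Formula} (hφ : IsSigma00 φ) :
      IsSigma00 (all (imp (lt (.var 0) t.shift) φ))

end Formula

open Formula in
/-- Natural deduction for two-sorted classical logic with equality of numbers: `Derivable T Γ φ`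
says that `φ` can be derived from the axioms in `T` under the finitely many hypotheses `Γ`.
Free variables of members of `T` are read as universally quantified; free variables of `Γ` are
parameters. -/
inductive Derivable (T : Formula → Prop) : List Formula → Formula → Prop
  | theory {Γ : List Formula} {φ : Formula} (h : T φ) : Derivable T Γ φ
  | hyp {Γ : List Formula} {φ : Formula} (h : φ ∈ Γ) : Derivable T Γ φ
  | impIntro {Γ : List Formula} {φ ψ : Formula} (h : Derivable T (φ :: Γ) ψ) :
      Derivable T Γ (imp φ ψ)
  | impElim {Γ : List Formula} {φ ψ : Formula} (h₁ : Derivable T Γ (imp φ ψ))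
      (h₂ : Derivable T Γ φ) : Derivable T Γ ψ
  | byContra {Γ : List Formula} {φ : Formula} (h : Derivable T (neg φ :: Γ) falsum) :
      Derivable T Γ φ
  | allIntro {Γ : List Formula} {φ : Formula} (h : Derivable T (Γ.map shift) φ) :
      Derivable T Γ (all φ)
  | allElim {Γ : List Formula} {φ : Formula} (t : Term) (h : Derivable T Γ (all φ)) :
      Derivable T Γ (φ.inst t)
  | allSetIntro {Γ : List Formula} {φ : Formula} (h : Derivable T (Γ.map shiftSet) φ) :
      Derivable T Γ (allSet φ)
  | allSetElim {Γ : List Formula} {φ : Formula} (Y : ℕ) (h : Derivable T Γ (allSet φ)) :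
      Derivable T Γ (φ.instSet Y)
  | eqRefl {Γ : List Formula} (t : Term) : Derivable T Γ (eq t t)
  | eqSubst {Γ : List Formula} {s t : Term} (φ : Formula) (h₁ : Derivable T Γ (eq s t))
      (h₂ : Derivable T Γ (φ.inst s)) : Derivable T Γ (φ.inst t)

/-- `T` proves `φ`. -/
def Proves (T : Formula → Prop) (φ : Formula) : Prop := Derivable T [] φ

open Term Formula in
/-- The axioms of `RCA₀*` (their universal closures are meant): the basic axioms of second order
arithmetic, the recursion equations of exponentiation, induction for `Σ⁰₀` formulas, and
comprehension for `Δ⁰₁` formulas.  In the basic axioms `m` is `var 1` and `n` is `var 0`. -/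
inductive RCA0Star : Formula → Prop
  | succ_ne_zero : RCA0Star (neg (eq (add (var 0) one) zero))
  | succ_inj :
      RCA0Star (imp (eq (add (var 1) one) (add (var 0) one)) (eq (var 1) (var 0)))
  | add_zero : RCA0Star (eq (add (var 1) zero) (var 1))
  | add_succ :
      RCA0Star (eq (add (var 1) (add (var 0) one)) (add (add (var 1) (var 0)) one))
  | mul_zero : RCA0Star (eq (mul (var 1) zero) zero)
  | mul_succ :
      RCA0Star (eq (mul (var 1) (add (var 0) one)) (add (mul (var 1) (var 0)) (var 1)))
  | not_lt_zero : RCA0Star (neg (lt (var 1) zero))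
  | lt_succ :
      RCA0Star (iff (lt (var 1) (add (var 0) one))
        (or (lt (var 1) (var 0)) (eq (var 1) (var 0))))
  | exp_zero : RCA0Star (eq (exp (var 1) zero) one)
  | exp_succ :
      RCA0Star (eq (exp (var 1) (add (var 0) one)) (mul (exp (var 1) (var 0)) (var 1)))
  | induction (φ : Formula) (hφ : IsSigma00 φ) :
      RCA0Star (imp (and (inst zero φ) (all (imp φ (instSucc φ)))) (all φ))
  | comprehension (φ ψ : Formula) (hφ : IsSigma00 φ) (hψ : IsSigma00 ψ) :
      RCA0Star (imp (all (iff (ex φ) (all ψ)))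
        (exSet (all (iff (mem (var 0) 0) (shiftSet (ex φ))))))

open Term Formula

/-- The code `(s + t)² + s` of the ordered pair of `s` and `t`. -/
def pairTerm (s t : Term) : Term := add (mul (add s t) (add s t)) s

/-- The set `F` is a function from `ℕ` to `{0, …, k - 1}`: every member of `F` is a pair `(i, j)`
with `j < k`, and for every `i` there is exactly one `j < k` with `(i, j) ∈ F`. -/
def isColoring (F : ℕ) (k : Term) : Formula :=
  and
    (all (imp (mem (var 0) F)
      (ex (ex (and (lt (var 0) k.shift.shift.shift) (eq (var 2) (pairTerm (var 1) (var 0))))))))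
    (all (ex (and
      (and (lt (var 0) k.shift.shift) (mem (pairTerm (var 1) (var 0)) F))
      (all (imp (and (lt (var 0) k.shift.shift.shift) (mem (pairTerm (var 2) (var 0)) F))
        (eq (var 0) (var 1)))))))

/-- `∀ x ≥ b, ∃ y ≥ b, x ≠ y ∧ F(x) = F(y)`, where `F(x) = F(y)` says that `(x, c) ∈ F` and
`(y, c) ∈ F` for some `c`. -/
def isBound (F : ℕ) (b : Term) : Formula :=
  all (imp (le b.shift (var 0))
    (ex (and (le b.shift.shift (var 0)) (and (neg (eq (var 1) (var 0)))
      (ex (and (mem (pairTerm (var 2) (var 0)) F) (mem (pairTerm (var 1) (var 0)) F)))))))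

/-- The sentence `ERT`: for every `k` and every `f : ℕ → k` there is a bound. -/
def ERT : Formula :=
  allSet (all (imp (isColoring 0 (var 0)) (ex (isBound 0 (var 0)))))

/-- The sentence `minERT`: for every `k` and every `f : ℕ → k` there is a least bound. -/
def minERT : Formula :=
  allSet (all (imp (isColoring 0 (var 0))
    (ex (and (isBound 0 (var 0)) (all (imp (isBound 0 (var 0)) (le (var 1) (var 0))))))))

end SecondOrder

/-! Provability. By completeness (`proves_of_forall_sat`) it suffices to argue in an arbitrary,
possibly nonstandard model of `RCA0Star`. A least bound is a bound, so only one direction has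
content. Being a bound involves unbounded quantifiers, whereas the least number principle is
available only for Σ⁰₀ formulas. Two applications of ERT overcome this. The first gives a bound b
for f. Now recolor: the first occurrence after b of each color keeps its color, and every other
number gets the new color k (`exists_graph_isFirst`). Each old color is used at most once by the new
coloring, so a bound d for it lies beyond all first occurrences. Hence every color present after b
already occurs between b and max b d. For c ≤ b, being a bound for f is then equivalent to a Σ⁰₀
condition, and a least such c exists (`exists_isLeast`).

Weihrauch equivalence. The identity reduces ERT to minERT. For the converse, `approxBound f n` is
the least bound for the first n values of f. Each change of this approximation increases a potential
that stays below (2k+1)^k (`potential_append`, `potential_lt`). Color stage n by 0 if the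
approximation does not change there, and otherwise by the number of changes so far
(`changeColoring`). No positive color repeats, so no change happens at or after a bound S for this
coloring (`approxBound_eq_of_isBound`). The approximation at stage S is therefore the limit, and the
limit is the least bound for f (`isLeast_of_eventually_const`). -/

namespace SecondOrder

/-! ### Substitution calculus -/

/-- The substitution `σ` under a number quantifier. -/
def upTerm (σ : ℕ → Term) : ℕ → Term := consTerm (.var 0) fun i => (σ i).shift

/-- The renaming `ρ` under a set quantifier. -/
def upSet (ρ : ℕ → ℕ) : ℕ → ℕ := consSet 0 fun i => ρ i + 1

theorem Term.subst_subst (σ τ : ℕ → Term) (t : Term) :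
    (t.subst σ).subst τ = t.subst fun i => (σ i).subst τ := by
  induction t <;> simp_all [Term.subst]

theorem Term.subst_var (t : Term) : t.subst .var = t := by
  induction t <;> simp_all [Term.subst]

theorem Term.shift_subst (τ : ℕ → Term) (t : Term) :
    t.shift.subst τ = t.subst fun i => τ (i + 1) := by
  simp [Term.shift, Term.subst_subst, Term.subst]

theorem Term.shift_subst_upTerm (τ : ℕ → Term) (t : Term) :
    t.shift.subst (upTerm τ) = (t.subst τ).shift := by
  rw [Term.shift_subst, Term.shift, Term.subst_subst]; rfl

theorem upTerm_var : upTerm .var = .var := by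
  funext i; cases i <;> rfl

theorem upSet_id : upSet id = id := by
  funext i; cases i <;> rfl

theorem upTerm_comp (σ τ : ℕ → Term) :
    (fun i => (upTerm σ i).subst (upTerm τ)) = upTerm fun i => (σ i).subst τ := by
  funext i
  cases i with
  | zero => rfl
  | succ i => exact Term.shift_subst_upTerm τ (σ i)

theorem upSet_comp (ρ θ : ℕ → ℕ) : (fun i => upSet θ (upSet ρ i)) = upSet fun i => θ (ρ i) := by
  funext i; cases i <;> rfl

namespace Formula

theorem subst_all (σ : ℕ → Term) (ρ : ℕ → ℕ) (φ : Formula) :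
    (all φ).subst σ ρ = all (φ.subst (upTerm σ) ρ) := rfl

theorem subst_allSet (σ : ℕ → Term) (ρ : ℕ → ℕ) (φ : Formula) :
    (allSet φ).subst σ ρ = allSet (φ.subst σ (upSet ρ)) := rfl

theorem subst_imp (σ : ℕ → Term) (ρ : ℕ → ℕ) (φ ψ : Formula) :
    (imp φ ψ).subst σ ρ = imp (φ.subst σ ρ) (ψ.subst σ ρ) := rfl

theorem subst_subst (σ τ : ℕ → Term) (ρ θ : ℕ → ℕ) (φ : Formula) :
    (φ.subst σ ρ).subst τ θ = φ.subst (fun i => (σ i).subst τ) fun i => θ (ρ i) := by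
  induction φ generalizing σ τ ρ θ with
  | falsum => rfl
  | eq s t => simp [subst, Term.subst_subst]
  | lt s t => simp [subst, Term.subst_subst]
  | mem t X => simp [subst, Term.subst_subst]
  | imp φ ψ h₁ h₂ => simp [subst, h₁, h₂]
  | all φ h => rw [subst_all, subst_all, subst_all, h, upTerm_comp]
  | allSet φ h => rw [subst_allSet, subst_allSet, subst_allSet, h, upSet_comp]

theorem subst_var_id (φ : Formula) : φ.subst .var id = φ := by
  induction φ with
  | all φ h => rw [subst_all, upTerm_var, h]
  | allSet φ h => rw [subst_allSet, upSet_id, h]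
  | _ => simp_all [subst, Term.subst_var]

theorem subst_shift (σ : ℕ → Term) (ρ : ℕ → ℕ) (φ : Formula) :
    φ.shift.subst (upTerm σ) ρ = (φ.subst σ ρ).shift := by
  rw [shift, subst_subst, shift, subst_subst]; rfl

theorem subst_shiftSet (σ : ℕ → Term) (ρ : ℕ → ℕ) (φ : Formula) :
    φ.shiftSet.subst σ (upSet ρ) = (φ.subst σ ρ).shiftSet := by
  rw [shiftSet, subst_subst, shiftSet, subst_subst]
  simp only [Term.subst_var]; rfl

theorem subst_upTerm_inst (σ : ℕ → Term) (ρ : ℕ → ℕ) (t : Term) (φ : Formula) :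
    (φ.subst (upTerm σ) ρ).inst t = φ.subst (consTerm t σ) ρ := by
  rw [inst, subst_subst]
  congr 1
  funext i
  cases i with
  | zero => rfl
  | succ i => exact (Term.shift_subst _ _).trans (Term.subst_var _)

theorem subst_upSet_instSet (σ : ℕ → Term) (ρ : ℕ → ℕ) (Y : ℕ) (φ : Formula) :
    (φ.subst σ (upSet ρ)).instSet Y = φ.subst σ (consSet Y ρ) := by
  rw [instSet, subst_subst]
  congr 1
  · funext i; exact Term.subst_var _
  · funext i; cases i <;> rfl

theorem inst_subst (σ : ℕ → Term) (ρ : ℕ → ℕ) (t : Term) (φ : Formula) :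
    (φ.inst t).subst σ ρ = (φ.subst (upTerm σ) ρ).inst (t.subst σ) := by
  rw [subst_upTerm_inst, inst, subst_subst]
  congr 1
  funext i; cases i <;> rfl

theorem instSet_subst (σ : ℕ → Term) (ρ : ℕ → ℕ) (Y : ℕ) (φ : Formula) :
    (φ.instSet Y).subst σ ρ = (φ.subst σ (upSet ρ)).instSet (ρ Y) := by
  rw [subst_upSet_instSet, instSet, subst_subst]
  congr 1
  funext i; cases i <;> rfl

theorem instSucc_subst (σ : ℕ → Term) (ρ : ℕ → ℕ) (φ : Formula) :
    φ.instSucc.subst (upTerm σ) ρ = (φ.subst (upTerm σ) ρ).instSucc := by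
  rw [instSucc, subst_subst, instSucc, subst_subst]
  congr 1
  funext i
  cases i with
  | zero => rfl
  | succ i => exact (show (σ i).shift = (σ i).shift.subst _ by rw [Term.shift_subst]; rfl)

theorem IsSigma00.subst {φ : Formula} (h : IsSigma00 φ) (σ : ℕ → Term) (ρ : ℕ → ℕ) :
    IsSigma00 (φ.subst σ ρ) := by
  induction h generalizing σ with
  | falsum => exact .falsum
  | eq s t => exact .eq _ _
  | lt s t => exact .lt _ _
  | mem t X => exact .mem _ _
  | imp _ _ h₁ h₂ => exact .imp (h₁ σ) (h₂ σ)
  | ball t _ h =>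
    have := IsSigma00.ball (t.subst σ) (h (upTerm σ))
    rwa [← Term.shift_subst_upTerm] at this

end Formula

/-! ### Free variables -/

/-- A strict upper bound for the variables of a term. -/
def Term.varBound : Term → ℕ
  | .var i => i + 1
  | .zero => 0
  | .one => 0
  | .add s t => max s.varBound t.varBound
  | .mul s t => max s.varBound t.varBound
  | .exp s t => max s.varBound t.varBound

theorem Term.subst_congr {σ τ : ℕ → Term} {t : Term} (h : ∀ i < t.varBound, σ i = τ i) :
    t.subst σ = t.subst τ := by
  induction t with
  | var i => exact h i (Nat.lt_succ_self i)
  | zero => rfl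
  | one => rfl
  | _ s t hs ht =>
    simp only [Term.varBound, lt_max_iff] at h
    simp only [Term.subst]
    rw [hs fun i hi => h i (.inl hi), ht fun i hi => h i (.inr hi)]

namespace Formula

/-- A strict upper bound for the number variables of a formula. -/
def varBound : Formula → ℕ
  | falsum => 0
  | eq s t => max s.varBound t.varBound
  | lt s t => max s.varBound t.varBound
  | mem t _ => t.varBound
  | imp φ ψ => max φ.varBound ψ.varBound
  | all φ => φ.varBound
  | allSet φ => φ.varBound

/-- A strict upper bound for the set variables of a formula. -/
def setBound : Formula → ℕ
  | falsum => 0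
  | eq _ _ => 0
  | lt _ _ => 0
  | mem _ X => X + 1
  | imp φ ψ => max φ.setBound ψ.setBound
  | all φ => φ.setBound
  | allSet φ => φ.setBound

theorem subst_congr {σ τ : ℕ → Term} {ρ θ : ℕ → ℕ} {φ : Formula}
    (h : ∀ i < φ.varBound, σ i = τ i) (h' : ∀ i < φ.setBound, ρ i = θ i) :
    φ.subst σ ρ = φ.subst τ θ := by
  induction φ generalizing σ τ ρ θ with
  | falsum => rfl
  | eq s t | lt s t =>
    simp only [varBound, lt_max_iff] at h
    simp only [subst]
    rw [Term.subst_congr fun i hi => h i (.inl hi), Term.subst_congr fun i hi => h i (.inr hi)]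
  | mem t X =>
    simp only [subst]
    rw [Term.subst_congr h, h' X (Nat.lt_succ_self X)]
  | imp φ ψ h₁ h₂ =>
    simp only [varBound, setBound, lt_max_iff] at h h'
    rw [subst_imp, subst_imp, h₁ (fun i hi => h i (.inl hi)) fun i hi => h' i (.inl hi),
      h₂ (fun i hi => h i (.inr hi)) fun i hi => h' i (.inr hi)]
  | all φ ih =>
    rw [subst_all, subst_all, ih _ h']
    rintro (_ | i) hi
    · rfl
    · exact congrArg Term.shift (h i (Nat.lt_of_succ_lt hi))
  | allSet φ ih =>
    rw [subst_allSet, subst_allSet, ih h]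
    rintro (_ | i) hi
    · rfl
    · exact congrArg (· + 1) (h' i (Nat.lt_of_succ_lt hi))

end Formula

/-! ### Derivations -/

open Formula

/-- Every substitution instance of a member of `T` is provable from `T`. -/
def SubstClosed (T : Formula → Prop) : Prop :=
  ∀ φ, T φ → ∀ σ ρ, Proves T (φ.subst σ ρ)

namespace Derivable

variable {T : Formula → Prop} {Γ Γ' : List Formula} {φ ψ : Formula}

theorem weaken (h : Derivable T Γ φ) (hΓ : Γ ⊆ Γ') : Derivable T Γ' φ := by
  induction h generalizing Γ' with
  | theory h => exact .theory h
  | hyp h => exact .hyp (hΓ h)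
  | impIntro _ ih => exact .impIntro (ih (List.cons_subset_cons _ hΓ))
  | impElim _ _ ih₁ ih₂ => exact .impElim (ih₁ hΓ) (ih₂ hΓ)
  | byContra _ ih => exact .byContra (ih (List.cons_subset_cons _ hΓ))
  | allIntro _ ih => exact .allIntro (ih (List.map_subset _ hΓ))
  | allElim t _ ih => exact .allElim t (ih hΓ)
  | allSetIntro _ ih => exact .allSetIntro (ih (List.map_subset _ hΓ))
  | allSetElim Y _ ih => exact .allSetElim Y (ih hΓ)
  | eqRefl t => exact .eqRefl t
  | eqSubst φ _ _ ih₁ ih₂ => exact .eqSubst φ (ih₁ hΓ) (ih₂ hΓ)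

/-- Needed to rename eigenvariables: the quantifier rules shift the whole context, while the Henkin
construction generalizes over a named fresh variable. -/
theorem subst (hT : SubstClosed T) (h : Derivable T Γ φ) (σ : ℕ → Term) (ρ : ℕ → ℕ) :
    Derivable T (Γ.map (Formula.subst σ ρ)) (φ.subst σ ρ) := by
  induction h generalizing σ ρ with
  | theory h => exact (hT _ h σ ρ).weaken (List.nil_subset _)
  | hyp h => exact .hyp (List.mem_map_of_mem h)
  | impIntro _ ih => exact .impIntro (ih σ ρ)
  | impElim _ _ ih₁ ih₂ => exact .impElim (ih₁ σ ρ) (ih₂ σ ρ)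
  | byContra _ ih => exact .byContra (ih σ ρ)
  | allIntro _ ih =>
    have := ih (upTerm σ) ρ
    rw [List.map_map] at this
    refine .allIntro ?_
    rw [List.map_map]
    convert this using 2
    · funext φ
      exact (subst_shift σ ρ φ).symm
    · rfl
  | allElim t _ ih =>
    rw [inst_subst]
    exact .allElim _ (ih σ ρ)
  | allSetIntro _ ih =>
    have := ih σ (upSet ρ)
    rw [List.map_map] at this
    refine .allSetIntro ?_
    rw [List.map_map]
    convert this using 2
    · funext φ
      exact (subst_shiftSet σ ρ φ).symm
    · rfl
  | allSetElim Y _ ih =>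
    rw [instSet_subst]
    exact .allSetElim _ (ih σ ρ)
  | eqRefl t => exact .eqRefl _
  | eqSubst φ _ _ ih₁ ih₂ =>
    rw [inst_subst]
    have := ih₂ σ ρ
    rw [inst_subst] at this
    exact .eqSubst _ (ih₁ σ ρ) this

/-- Generalization on a variable that is not free in the hypotheses. -/
theorem all_of_fresh (hT : SubstClosed T) {m : ℕ} (hΓ : ∀ χ ∈ Γ, χ.varBound ≤ m)
    (hφ : φ.varBound ≤ m) (h : Derivable T Γ (φ.inst (.var m))) : Derivable T Γ (all φ) := by
  -- `τ` turns the fresh variable `m` into the variable about to be bound. Below `m` it is the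
  -- shift, so it shifts `Γ` and undoes the instantiation of `φ`.
  let τ : ℕ → Term := fun i => if i = m then .var 0 else .var (i + 1)
  have hτ : ∀ i < m, τ i = .var (i + 1) := fun i hi => if_neg hi.ne
  have key := h.subst hT τ id
  have h₁ : Γ.map (Formula.subst τ id) = Γ.map Formula.shift :=
    List.map_congr_left fun χ hχ =>
      subst_congr (fun i hi => hτ i (hi.trans_le (hΓ χ hχ))) fun _ _ => rfl
  have h₂ : (φ.inst (.var m)).subst τ id = φ := by
    rw [inst_subst, subst_upTerm_inst]
    refine (subst_congr (fun i hi => ?_) fun _ _ => rfl).trans (subst_var_id φ)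
    rcases i with _ | i
    · exact if_pos rfl
    · exact hτ i ((Nat.lt_succ_self i).trans (hi.trans_le hφ))
  rw [h₁, h₂] at key
  exact .allIntro key

/-- Generalization on a set variable that is not free in the hypotheses. -/
theorem allSet_of_fresh (hT : SubstClosed T) {m : ℕ} (hΓ : ∀ χ ∈ Γ, χ.setBound ≤ m)
    (hφ : φ.setBound ≤ m) (h : Derivable T Γ (φ.instSet m)) : Derivable T Γ (allSet φ) := by
  let θ : ℕ → ℕ := fun i => if i = m then 0 else i + 1
  have hθ : ∀ i < m, θ i = i + 1 := fun i hi => if_neg hi.ne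
  have key := h.subst hT .var θ
  have h₁ : Γ.map (Formula.subst .var θ) = Γ.map Formula.shiftSet :=
    List.map_congr_left fun χ hχ =>
      subst_congr (fun _ _ => rfl) fun i hi => hθ i (hi.trans_le (hΓ χ hχ))
  have h₂ : (φ.instSet m).subst .var θ = φ := by
    rw [instSet_subst, subst_upSet_instSet]
    refine (subst_congr (fun _ _ => rfl) fun i hi => ?_).trans (subst_var_id φ)
    rcases i with _ | i
    · exact if_pos rfl
    · exact hθ i ((Nat.lt_succ_self i).trans (hi.trans_le hφ))
  rw [h₁, h₂] at key
  exact .allSetIntro key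

theorem subst_two (h : Proves T φ) (s t : Term) :
    Proves T (φ.subst (consTerm t (consTerm s .var)) id) := by
  have h₁ : Proves T (all φ) := .allIntro h
  have h₂ : Proves T (all (all φ)) := .allIntro h₁
  have h₃ : Proves T ((φ.subst (upTerm (consTerm s .var)) id).inst t) :=
    .allElim t (.allElim s h₂)
  rwa [subst_upTerm_inst] at h₃

end Derivable

theorem substClosed_RCA0Star : SubstClosed RCA0Star := by
  intro φ hφ σ ρ
  -- The basic axioms mention only variables 0 and 1, so generalizing and specializing twice yields
  -- every instance. The two schemes are closed under substitution outright.
  have two : ∀ {χ : Formula}, RCA0Star χ →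
      χ.subst σ ρ = χ.subst (consTerm (σ 0) (consTerm (σ 1) .var)) id →
      Proves RCA0Star (χ.subst σ ρ) := fun h e => e ▸ Derivable.subst_two (.theory h) _ _
  cases hφ with
  | induction φ hφ =>
    refine .theory ?_
    have := RCA0Star.induction _ (hφ.subst (upTerm σ) ρ)
    rw [← instSucc_subst] at this
    convert this using 1
    change imp (neg (imp ((inst Term.zero φ).subst σ ρ) _)) _ = _
    rw [inst_subst]; rfl
  | comprehension φ ψ hφ hψ =>
    refine .theory ?_
    have := RCA0Star.comprehension _ _ (hφ.subst (upTerm (upTerm σ)) ρ)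
      (hψ.subst (upTerm (upTerm σ)) ρ)
    convert this using 1
    have e : (shiftSet (ex φ)).subst (upTerm σ) (upSet ρ) =
        shiftSet (ex (φ.subst (upTerm (upTerm σ)) ρ)) := subst_shiftSet _ _ _
    rw [← e]; rfl
  | succ_ne_zero => exact two .succ_ne_zero rfl
  | succ_inj => exact two .succ_inj rfl
  | add_zero => exact two .add_zero rfl
  | add_succ => exact two .add_succ rfl
  | mul_zero => exact two .mul_zero rfl
  | mul_succ => exact two .mul_succ rfl
  | not_lt_zero => exact two .not_lt_zero rfl
  | lt_succ => exact two .lt_succ rfl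
  | exp_zero => exact two .exp_zero rfl
  | exp_succ => exact two .exp_succ rfl

end SecondOrder

namespace SecondOrder

open Formula

/-! ### Enumeration of the formulas -/

/-- A numerical code of a term. -/
def Term.code : Term → ℕ
  | .var i => Nat.pair 0 i
  | .zero => Nat.pair 1 0
  | .one => Nat.pair 2 0
  | .add s t => Nat.pair 3 (Nat.pair s.code t.code)
  | .mul s t => Nat.pair 4 (Nat.pair s.code t.code)
  | .exp s t => Nat.pair 5 (Nat.pair s.code t.code)

theorem Term.code_injective : Function.Injective Term.code := by
  intro s
  induction s with
  | add s t hs ht | mul s t hs ht | exp s t hs ht =>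
    rintro (_ | _ | _ | _ | _ | _) h <;> simp [Term.code, Nat.pair_eq_pair] at h
    exact congrArg₂ _ (hs h.1) (ht h.2)
  | _ => rintro (_ | _ | _ | _ | _ | _) h <;> simp_all [Term.code, Nat.pair_eq_pair]

/-- A numerical code of a formula. -/
def Formula.code : Formula → ℕ
  | falsum => Nat.pair 0 0
  | eq s t => Nat.pair 1 (Nat.pair s.code t.code)
  | lt s t => Nat.pair 2 (Nat.pair s.code t.code)
  | mem t X => Nat.pair 3 (Nat.pair t.code X)
  | imp φ ψ => Nat.pair 4 (Nat.pair φ.code ψ.code)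
  | all φ => Nat.pair 5 φ.code
  | allSet φ => Nat.pair 6 φ.code

theorem Formula.code_injective : Function.Injective Formula.code := by
  intro φ
  induction φ with
  | falsum => rintro (_ | _ | _ | _ | _ | _ | _) h <;> simp [Formula.code, Nat.pair_eq_pair] at h ⊢
  | eq s t | lt s t =>
    rintro (_ | _ | _ | _ | _ | _ | _) h <;> simp [Formula.code, Nat.pair_eq_pair] at h
    exact congrArg₂ _ (Term.code_injective h.1) (Term.code_injective h.2)
  | mem t X =>
    rintro (_ | _ | _ | _ | _ | _ | _) h <;> simp [Formula.code, Nat.pair_eq_pair] at h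
    exact congrArg₂ _ (Term.code_injective h.1) h.2
  | imp φ ψ h₁ h₂ =>
    rintro (_ | _ | _ | _ | _ | _ | _) h <;> simp [Formula.code, Nat.pair_eq_pair] at h
    exact congrArg₂ _ (h₁ h.1) (h₂ h.2)
  | all φ ih | allSet φ ih =>
    rintro (_ | _ | _ | _ | _ | _ | _) h <;> simp [Formula.code, Nat.pair_eq_pair] at h
    exact congrArg _ (ih h)

instance : Countable Formula := Formula.code_injective.countable

instance : Nonempty Formula := ⟨falsum⟩

/-! ### Maximal consistent sets of formulas with witnesses -/

/-- A deductively closed, consistent, complete set of formulas with witnesses for both kinds of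
quantifiers. -/
structure IsHenkin (T : Formula → Prop) (Δ : Set Formula) : Prop where
  mem_of_derivable {Γ : List Formula} {φ : Formula} :
    (∀ ψ ∈ Γ, ψ ∈ Δ) → Derivable T Γ φ → φ ∈ Δ
  falsum_notMem : falsum ∉ Δ
  mem_or_neg_mem (φ : Formula) : φ ∈ Δ ∨ neg φ ∈ Δ
  exists_witness {φ : Formula} : all φ ∉ Δ → ∃ t, φ.inst t ∉ Δ
  exists_witnessSet {φ : Formula} : allSet φ ∉ Δ → ∃ Y, φ.instSet Y ∉ Δ

/-- No contradiction follows from `Γ`. -/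
def Consistent (T : Formula → Prop) (Γ : List Formula) : Prop := ¬ Derivable T Γ falsum

section Extension

variable {T : Formula → Prop} {Γ : List Formula} {φ : Formula}

theorem Consistent.neg_cons (h : Consistent T Γ) (hφ : ¬ Consistent T (φ :: Γ)) :
    Consistent T (neg φ :: Γ) := fun h' =>
  h (.impElim (.impIntro (not_not.1 hφ)) (.byContra h'))

/-- Since `Γ` is a finite list, some variable is fresh for it and serves as the Henkin witness; no
new constants are required. -/
theorem exists_all_witness (hT : SubstClosed T) (h : Consistent T Γ) (hφ : neg (all φ) ∈ Γ) :
    ∃ t, Consistent T (neg (φ.inst t) :: Γ) := by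
  obtain ⟨m, hm⟩ : ∃ m, ∀ χ ∈ φ :: Γ, χ.varBound ≤ m :=
    ⟨((φ :: Γ).map varBound).sum, fun χ hχ => List.le_sum_of_mem (List.mem_map_of_mem hχ)⟩
  refine ⟨.var m, fun h' => h (.impElim (.hyp hφ) ?_)⟩
  exact Derivable.all_of_fresh hT (fun χ hχ => hm χ (List.mem_cons_of_mem _ hχ))
    (hm φ List.mem_cons_self) (.byContra h')

theorem exists_allSet_witness (hT : SubstClosed T) (h : Consistent T Γ)
    (hφ : neg (allSet φ) ∈ Γ) : ∃ Y, Consistent T (neg (φ.instSet Y) :: Γ) := by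
  obtain ⟨m, hm⟩ : ∃ m, ∀ χ ∈ φ :: Γ, χ.setBound ≤ m :=
    ⟨((φ :: Γ).map setBound).sum, fun χ hχ => List.le_sum_of_mem (List.mem_map_of_mem hχ)⟩
  refine ⟨m, fun h' => h (.impElim (.hyp hφ) ?_)⟩
  exact Derivable.allSet_of_fresh hT (fun χ hχ => hm χ (List.mem_cons_of_mem _ hχ))
    (hm φ List.mem_cons_self) (.byContra h')

/-- A consistent list of formulas can be extended to one that decides `φ`, with a witness if `φ` is
a refuted universal formula. -/
theorem exists_extension (hT : SubstClosed T) (h : Consistent T Γ) (φ : Formula) :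
    ∃ Γ', Consistent T Γ' ∧ Γ ⊆ Γ' ∧ (φ ∈ Γ' ∨ neg φ ∈ Γ') ∧
      (∀ ψ, φ = all ψ → φ ∈ Γ' ∨ ∃ t, neg (ψ.inst t) ∈ Γ') ∧
      ∀ ψ, φ = allSet ψ → φ ∈ Γ' ∨ ∃ Y, neg (ψ.instSet Y) ∈ Γ' := by
  by_cases hφ : Consistent T (φ :: Γ)
  · exact ⟨φ :: Γ, hφ, List.subset_cons_self _ _, .inl List.mem_cons_self,
      fun _ _ => .inl List.mem_cons_self, fun _ _ => .inl List.mem_cons_self⟩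
  have h' := h.neg_cons hφ
  have hsub : ∀ χ, Γ ⊆ χ :: neg φ :: Γ := fun χ _ h =>
    List.mem_cons_of_mem _ (List.mem_cons_of_mem _ h)
  have hmem : ∀ χ, neg φ ∈ χ :: neg φ :: Γ := fun χ => List.mem_cons_of_mem _ List.mem_cons_self
  by_cases h₁ : ∃ ψ, φ = all ψ
  · obtain ⟨ψ, rfl⟩ := h₁
    obtain ⟨t, ht⟩ := exists_all_witness hT h' List.mem_cons_self
    refine ⟨_, ht, hsub _, .inr (hmem _), ?_, nofun⟩
    rintro _ ⟨⟩
    exact .inr ⟨t, List.mem_cons_self⟩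
  by_cases h₂ : ∃ ψ, φ = allSet ψ
  · obtain ⟨ψ, rfl⟩ := h₂
    obtain ⟨Y, hY⟩ := exists_allSet_witness hT h' List.mem_cons_self
    refine ⟨_, hY, hsub _, .inr (hmem _), nofun, ?_⟩
    rintro _ ⟨⟩
    exact .inr ⟨Y, List.mem_cons_self⟩
  exact ⟨_, h', List.subset_cons_self _ _, .inr List.mem_cons_self,
    fun ψ hψ => (h₁ ⟨ψ, hψ⟩).elim, fun ψ hψ => (h₂ ⟨ψ, hψ⟩).elim⟩

/-- Lindenbaum's construction: decide the formulas one by one along an enumeration, adding witnesses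
at once, and take the union. Every finite part of the union lies in one consistent stage. -/
theorem exists_isHenkin (hT : SubstClosed T) (h : Consistent T Γ) :
    ∃ Δ : Set Formula, IsHenkin T Δ ∧ ∀ φ ∈ Γ, φ ∈ Δ := by
  obtain ⟨e, he⟩ := exists_surjective_nat Formula
  choose next hnext using fun (G : {G // Consistent T G}) (φ : Formula) =>
    exists_extension hT G.2 φ
  let G : ℕ → {G // Consistent T G} := fun n =>
    n.rec ⟨Γ, h⟩ fun n G => ⟨next G (e n), (hnext G (e n)).1⟩
  have hG : ∀ n, (G (n + 1)).1 = next (G n) (e n) := fun _ => rfl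
  have mono : Monotone fun n => {φ | φ ∈ (G n).1} :=
    monotone_nat_of_le_succ fun n φ hφ => (hnext (G n) (e n)).2.1 hφ
  have cover : ∀ L : List Formula, (∀ ψ ∈ L, ∃ n, ψ ∈ (G n).1) → ∃ n, L ⊆ (G n).1 := by
    intro L
    induction L with
    | nil => exact fun _ => ⟨0, List.nil_subset _⟩
    | cons φ L ih =>
      intro hL
      obtain ⟨n, hn⟩ := hL φ List.mem_cons_self
      obtain ⟨m, hm⟩ := ih fun ψ hψ => hL ψ (List.mem_cons_of_mem _ hψ)
      exact ⟨max n m, List.cons_subset.2 ⟨mono (le_max_left n m) hn,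
        fun ψ hψ => mono (le_max_right n m) (hm hψ)⟩⟩
  have cons : ∀ L : List Formula, (∀ ψ ∈ L, ∃ n, ψ ∈ (G n).1) → Consistent T L := fun L hL hd =>
    let ⟨n, hn⟩ := cover L hL
    (G n).2 (hd.weaken hn)
  have complete : ∀ φ, (∃ n, φ ∈ (G n).1) ∨ ∃ n, neg φ ∈ (G n).1 := fun φ => by
    obtain ⟨n, rfl⟩ := he φ
    exact (hnext (G n) (e n)).2.2.1.imp (fun h => ⟨n + 1, h⟩) fun h => ⟨n + 1, h⟩
  have contra : ∀ φ, (∃ n, φ ∈ (G n).1) → (∃ n, neg φ ∈ (G n).1) → False := fun φ h₁ h₂ =>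
    cons [φ, neg φ] (by simp [h₁, h₂])
      (.impElim (φ := φ) (.hyp (by simp [neg])) (.hyp (by simp)))
  refine ⟨{φ | ∃ n, φ ∈ (G n).1}, ⟨fun {L φ} hL hd => ?_, fun hn => ?_, complete, ?_, ?_⟩,
    fun φ hφ => ⟨0, hφ⟩⟩
  · refine (complete φ).resolve_right fun hn => ?_
    refine cons (neg φ :: L) (by simpa using ⟨hn, hL⟩) ?_
    exact .impElim (φ := φ) (.hyp List.mem_cons_self) (hd.weaken (List.subset_cons_self _ _))
  · exact cons [falsum] (by simpa using hn) (.hyp List.mem_cons_self)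
  · intro φ hφ
    obtain ⟨n, hn⟩ := he (all φ)
    obtain ⟨t, ht⟩ := ((hnext (G n) (e n)).2.2.2.1 φ hn).resolve_left fun h =>
      hφ ⟨n + 1, by rw [hG]; rwa [hn] at h ⊢⟩
    exact ⟨t, fun h' => contra _ h' ⟨n + 1, ht⟩⟩
  · intro φ hφ
    obtain ⟨n, hn⟩ := he (allSet φ)
    obtain ⟨t, ht⟩ := ((hnext (G n) (e n)).2.2.2.2 φ hn).resolve_left fun h =>
      hφ ⟨n + 1, by rw [hG]; rwa [hn] at h ⊢⟩
    exact ⟨t, fun h' => contra _ h' ⟨n + 1, ht⟩⟩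

end Extension

/-! ### Semantics -/

/-- A Henkin interpretation of the language of second order arithmetic with exponentiation. -/
structure Interp where
  /-- the numbers -/
  Num : Type
  /-- the sets -/
  Sets : Type
  /-- the number zero -/
  zero : Num
  /-- the number one -/
  one : Num
  /-- addition -/
  add : Num → Num → Num
  /-- multiplication -/
  mul : Num → Num → Num
  /-- exponentiation -/
  exp : Num → Num → Num
  /-- the order -/
  lt : Num → Num → Prop
  /-- membership -/
  mem : Num → Sets → Prop
  /-- some set -/
  someSet : Sets

namespace Interp

variable (A : Interp)

instance : Zero A.Num := ⟨A.zero⟩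
instance : One A.Num := ⟨A.one⟩
instance : Add A.Num := ⟨A.add⟩
instance : Mul A.Num := ⟨A.mul⟩
instance : LT A.Num := ⟨A.lt⟩
instance : Membership A.Num A.Sets := ⟨fun X n => A.mem n X⟩

/-- Extend an assignment by a value of variable `0`. -/
def cons {α : Type} (a : α) (v : ℕ → α) : ℕ → α
  | 0 => a
  | i + 1 => v i

@[simp] theorem cons_zero {α : Type} (a : α) (v : ℕ → α) : cons a v 0 = a := rfl

@[simp] theorem cons_succ {α : Type} (a : α) (v : ℕ → α) (i : ℕ) : cons a v (i + 1) = v i := rfl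

end Interp

open Interp

/-- The value of a term. -/
@[simp] def Term.eval (A : Interp) (v : ℕ → A.Num) : Term → A.Num
  | .var i => v i
  | .zero => 0
  | .one => 1
  | .add s t => s.eval A v + t.eval A v
  | .mul s t => s.eval A v * t.eval A v
  | .exp s t => A.exp (s.eval A v) (t.eval A v)

/-- Truth of a formula under an assignment. -/
@[simp] def Formula.Sat (A : Interp) : (ℕ → A.Num) → (ℕ → A.Sets) → Formula → Prop
  | _, _, falsum => False
  | v, _, eq s t => s.eval A v = t.eval A v
  | v, _, lt s t => s.eval A v < t.eval A v
  | v, V, mem t X => t.eval A v ∈ V X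
  | v, V, imp φ ψ => Sat A v V φ → Sat A v V ψ
  | v, V, all φ => ∀ n, Sat A (cons n v) V φ
  | v, V, allSet φ => ∀ X, Sat A v (cons X V) φ

theorem Term.eval_subst (A : Interp) (v : ℕ → A.Num) (σ : ℕ → Term) (t : Term) :
    (t.subst σ).eval A v = t.eval A fun i => (σ i).eval A v := by
  induction t <;> simp_all [Term.subst]

@[simp] theorem Term.eval_shift (A : Interp) (v : ℕ → A.Num) (n : A.Num) (t : Term) :
    t.shift.eval A (cons n v) = t.eval A v := Term.eval_subst A _ _ t

namespace Formula

variable {A : Interp} {v : ℕ → A.Num} {V : ℕ → A.Sets} {φ ψ : Formula}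

theorem sat_subst (σ : ℕ → Term) (ρ : ℕ → ℕ) :
    (φ.subst σ ρ).Sat A v V ↔ φ.Sat A (fun i => (σ i).eval A v) fun i => V (ρ i) := by
  induction φ generalizing v V σ ρ with
  | falsum => rfl
  | eq s t | lt s t => simp [subst, Term.eval_subst]
  | mem t X => simp [subst, Term.eval_subst]
  | imp φ ψ h₁ h₂ => simp [subst, h₁, h₂]
  | all φ ih =>
    rw [subst_all]
    refine forall_congr' fun n => (ih _ _).trans (iff_of_eq ?_)
    congr 1
    funext i
    cases i with
    | zero => rfl
    | succ i => exact Term.eval_shift A v n (σ i)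
  | allSet φ ih =>
    rw [subst_allSet]
    refine forall_congr' fun X => (ih _ _).trans (iff_of_eq ?_)
    congr 1
    funext i
    cases i <;> rfl

@[simp] theorem sat_shift (n : A.Num) : φ.shift.Sat A (cons n v) V ↔ φ.Sat A v V := sat_subst _ _

@[simp] theorem sat_shiftSet (X : A.Sets) : φ.shiftSet.Sat A v (cons X V) ↔ φ.Sat A v V :=
  sat_subst _ _

theorem sat_inst (t : Term) : (φ.inst t).Sat A v V ↔ φ.Sat A (cons (t.eval A v) v) V := by
  refine (sat_subst _ _).trans (iff_of_eq ?_)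
  congr 1
  funext i
  cases i <;> rfl

theorem sat_instSucc (n : A.Num) :
    φ.instSucc.Sat A (cons n v) V ↔ φ.Sat A (cons (n + 1) v) V := by
  refine (sat_subst _ _).trans (iff_of_eq ?_)
  congr 1
  funext i
  cases i <;> rfl

@[simp] theorem sat_neg : (neg φ).Sat A v V ↔ ¬ φ.Sat A v V := Iff.rfl

@[simp] theorem sat_and : (φ.and ψ).Sat A v V ↔ φ.Sat A v V ∧ ψ.Sat A v V := by
  simp [Formula.and]

@[simp] theorem sat_or : (φ.or ψ).Sat A v V ↔ φ.Sat A v V ∨ ψ.Sat A v V := by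
  simp [Formula.or, or_iff_not_imp_left]

@[simp] theorem sat_iff : (φ.iff ψ).Sat A v V ↔ (φ.Sat A v V ↔ ψ.Sat A v V) := by
  simp [Formula.iff, iff_iff_implies_and_implies]

@[simp] theorem sat_ex : (ex φ).Sat A v V ↔ ∃ n, φ.Sat A (cons n v) V := by
  simp [ex]

@[simp] theorem sat_exSet : (exSet φ).Sat A v V ↔ ∃ X, φ.Sat A v (cons X V) := by
  simp [exSet]

@[simp] theorem sat_le (s t : Term) :
    (le s t).Sat A v V ↔ s.eval A v < t.eval A v ∨ s.eval A v = t.eval A v := by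
  simp [le]

end Formula

/-! ### Completeness -/

namespace IsHenkin

variable {T : Formula → Prop} {Δ : Set Formula}

theorem imp_mem_iff (hΔ : IsHenkin T Δ) {φ ψ : Formula} : imp φ ψ ∈ Δ ↔ (φ ∈ Δ → ψ ∈ Δ) := by
  refine ⟨fun h hφ => hΔ.mem_of_derivable (Γ := [imp φ ψ, φ]) (by simp [h, hφ])
    (.impElim (.hyp (by simp)) (.hyp (by simp) : Derivable T _ φ)), fun h => ?_⟩
  rcases hΔ.mem_or_neg_mem φ with hφ | hφ
  · exact hΔ.mem_of_derivable (Γ := [ψ]) (by simp [h hφ]) (.impIntro (.hyp (by simp)))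
  · exact hΔ.mem_of_derivable (Γ := [neg φ]) (by simp [hφ])
      (.impIntro (.byContra (.impElim (φ := φ) (.hyp (by simp [neg])) (.hyp (by simp)))))

theorem all_mem_iff (hΔ : IsHenkin T Δ) {φ : Formula} : all φ ∈ Δ ↔ ∀ t, φ.inst t ∈ Δ := by
  refine ⟨fun h t => hΔ.mem_of_derivable (Γ := [all φ]) (by simp [h])
    (.allElim t (.hyp (by simp))), fun h => ?_⟩
  by_contra h'
  obtain ⟨t, ht⟩ := hΔ.exists_witness h'
  exact ht (h t)

theorem allSet_mem_iff (hΔ : IsHenkin T Δ) {φ : Formula} :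
    allSet φ ∈ Δ ↔ ∀ Y, φ.instSet Y ∈ Δ := by
  refine ⟨fun h t => hΔ.mem_of_derivable (Γ := [allSet φ]) (by simp [h])
    (.allSetElim t (.hyp (by simp))), fun h => ?_⟩
  by_contra h'
  obtain ⟨t, ht⟩ := hΔ.exists_witnessSet h'
  exact ht (h t)

theorem eq_refl_mem (hΔ : IsHenkin T Δ) (t : Term) : eq t t ∈ Δ :=
  hΔ.mem_of_derivable (Γ := []) (by simp) (.eqRefl t)

theorem inst_mem_of_eq_mem (hΔ : IsHenkin T Δ) {s t : Term} (φ : Formula) (h : eq s t ∈ Δ)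
    (hφ : φ.inst s ∈ Δ) : φ.inst t ∈ Δ :=
  hΔ.mem_of_derivable (Γ := [eq s t, φ.inst s]) (by simp [h, hφ])
    (.eqSubst φ (s := s) (.hyp (by simp)) (.hyp (by simp)))

theorem shift_inst (s t : Term) : t.shift.subst (consTerm s .var) = t :=
  (Term.shift_subst _ t).trans (Term.subst_var t)

theorem eq_symm_mem (hΔ : IsHenkin T Δ) {s t : Term} (h : eq s t ∈ Δ) : eq t s ∈ Δ := by
  have := hΔ.inst_mem_of_eq_mem (eq (.var 0) s.shift) h
  simp only [inst, Formula.subst, shift_inst] at this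
  exact this (hΔ.eq_refl_mem s)

theorem eq_trans_mem (hΔ : IsHenkin T Δ) {s t u : Term} (h : eq s t ∈ Δ) (h' : eq t u ∈ Δ) :
    eq s u ∈ Δ := by
  have := hΔ.inst_mem_of_eq_mem (eq s.shift (.var 0)) h'
  simp only [inst, Formula.subst, shift_inst] at this
  exact this h

/-- Leibniz replacement in one argument at a time; shifting protects the other terms from the
instantiation. -/
theorem eq_congr_mem (hΔ : IsHenkin T Δ) (f : Term → Term → Term)
    (hf : ∀ σ s t, (f s t).subst σ = f (s.subst σ) (t.subst σ)) {s s' t t' : Term}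
    (hs : eq s s' ∈ Δ) (ht : eq t t' ∈ Δ) : eq (f s t) (f s' t') ∈ Δ := by
  have h₁ := hΔ.inst_mem_of_eq_mem (eq (f s.shift t.shift) (f (.var 0) t.shift)) hs
  have h₂ := hΔ.inst_mem_of_eq_mem (eq (f s'.shift t.shift) (f s'.shift (.var 0))) ht
  simp only [inst, Formula.subst, hf, shift_inst] at h₁ h₂
  exact hΔ.eq_trans_mem (h₁ (hΔ.eq_refl_mem _)) (h₂ (hΔ.eq_refl_mem _))

theorem lt_congr_mem (hΔ : IsHenkin T Δ) {s s' t t' : Term}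
    (hs : eq s s' ∈ Δ) (ht : eq t t' ∈ Δ) (h : lt s t ∈ Δ) : lt s' t' ∈ Δ := by
  have h₁ := hΔ.inst_mem_of_eq_mem (lt (.var 0) t.shift) hs
  have h₂ := hΔ.inst_mem_of_eq_mem (lt s'.shift (.var 0)) ht
  simp only [inst, Formula.subst, shift_inst] at h₁ h₂
  exact h₂ (h₁ h)

/-- Terms are identified if their equality belongs to `Δ`. -/
def termSetoid (hΔ : IsHenkin T Δ) : Setoid Term where
  r s t := eq s t ∈ Δ
  iseqv := ⟨hΔ.eq_refl_mem, hΔ.eq_symm_mem, hΔ.eq_trans_mem⟩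

/-- The term model: numbers are classes of terms and sets are set variables. -/
def interp (hΔ : IsHenkin T Δ) : Interp where
  Num := Quotient hΔ.termSetoid
  Sets := ℕ
  zero := Quotient.mk _ .zero
  one := Quotient.mk _ .one
  add := Quotient.map₂ .add fun _ _ hs _ _ ht => hΔ.eq_congr_mem .add (fun _ _ _ => rfl) hs ht
  mul := Quotient.map₂ .mul fun _ _ hs _ _ ht => hΔ.eq_congr_mem .mul (fun _ _ _ => rfl) hs ht
  exp := Quotient.map₂ .exp fun _ _ hs _ _ ht => hΔ.eq_congr_mem .exp (fun _ _ _ => rfl) hs ht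
  lt := Quotient.lift₂ (fun s t => Formula.lt s t ∈ Δ) fun _ _ _ _ hs ht =>
    propext ⟨hΔ.lt_congr_mem hs ht, hΔ.lt_congr_mem (hΔ.eq_symm_mem hs) (hΔ.eq_symm_mem ht)⟩
  mem n X := Quotient.lift (fun t => Formula.mem t X ∈ Δ) (fun _ _ h =>
    propext ⟨hΔ.inst_mem_of_eq_mem (.mem (.var 0) X) h,
      hΔ.inst_mem_of_eq_mem (.mem (.var 0) X) (hΔ.eq_symm_mem h)⟩) n
  someSet := (0 : ℕ)

/-- The class of a term in the term model. -/
def termClass (hΔ : IsHenkin T Δ) (t : Term) : hΔ.interp.Num := Quotient.mk hΔ.termSetoid t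

theorem termClass_surjective (hΔ : IsHenkin T Δ) : Function.Surjective hΔ.termClass :=
  Quotient.exists_rep

theorem termClass_eq_termClass (hΔ : IsHenkin T Δ) {s t : Term} :
    hΔ.termClass s = hΔ.termClass t ↔ eq s t ∈ Δ :=
  Quotient.eq (r := hΔ.termSetoid)

theorem eval_interp (hΔ : IsHenkin T Δ) (σ : ℕ → Term) (t : Term) :
    t.eval hΔ.interp (fun i => hΔ.termClass (σ i)) = hΔ.termClass (t.subst σ) := by
  induction t with
  | var i => rfl
  | zero => rfl
  | one => rfl
  | _ s t hs ht => rw [Term.eval, hs, ht]; rfl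

theorem cons_termClass (hΔ : IsHenkin T Δ) (σ : ℕ → Term) (t : Term) :
    (cons (hΔ.termClass t) fun i => hΔ.termClass (σ i)) = fun i => hΔ.termClass (consTerm t σ i) := by
  funext i; cases i <;> rfl

/-- Truth in the term model is membership in `Δ`. -/
theorem sat_interp (hΔ : IsHenkin T Δ) (φ : Formula) (σ : ℕ → Term) (ρ : ℕ → ℕ) :
    φ.Sat hΔ.interp (fun i => hΔ.termClass (σ i)) ρ ↔ φ.subst σ ρ ∈ Δ := by
  induction φ generalizing σ ρ with
  | falsum => exact iff_of_false id hΔ.falsum_notMem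
  | eq s t =>
    change s.eval hΔ.interp _ = t.eval hΔ.interp _ ↔ _
    rw [eval_interp, eval_interp, termClass_eq_termClass]; rfl
  | lt s t =>
    change s.eval hΔ.interp _ < t.eval hΔ.interp _ ↔ _
    rw [eval_interp, eval_interp]; rfl
  | mem t X =>
    change hΔ.interp.mem (t.eval hΔ.interp _) (ρ X) ↔ _
    rw [eval_interp]; rfl
  | imp φ ψ h₁ h₂ =>
    rw [subst_imp, hΔ.imp_mem_iff, ← h₁, ← h₂]
    rfl
  | all φ ih =>
    rw [subst_all, hΔ.all_mem_iff]
    refine hΔ.termClass_surjective.forall.trans <| forall_congr' fun t => ?_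
    rw [subst_upTerm_inst, cons_termClass, ih]
  | allSet φ ih =>
    rw [subst_allSet, hΔ.allSet_mem_iff]
    refine forall_congr' fun Y => ?_
    refine Iff.trans (iff_of_eq (congrArg (fun V => Sat hΔ.interp _ V φ) ?_))
      ((ih σ (consSet Y ρ)).trans
      (iff_of_eq (congrArg (· ∈ Δ) (subst_upSet_instSet σ ρ Y φ).symm)))
    funext i; cases i <;> rfl

end IsHenkin

/-- All members of `T` hold in `A`, under every assignment. -/
def Interp.IsModel (A : Interp) (T : Formula → Prop) : Prop :=
  ∀ φ, T φ → ∀ v V, φ.Sat A v V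

theorem IsHenkin.isModel_interp {T : Formula → Prop} {Δ : Set Formula} (hT : SubstClosed T)
    (hΔ : IsHenkin T Δ) : hΔ.interp.IsModel T := by
  intro φ hφ v V
  -- Every assignment comes from a substitution, so truth under it is membership of a substitution
  -- instance of the axiom.
  choose σ hσ using fun i => hΔ.termClass_surjective (v i)
  obtain rfl : (fun i => hΔ.termClass (σ i)) = v := funext hσ
  exact (hΔ.sat_interp φ σ V).2 (hΔ.mem_of_derivable (Γ := []) (by simp) (hT φ hφ σ V))

/-- The completeness theorem. -/
theorem proves_of_forall_sat {T : Formula → Prop} (hT : SubstClosed T) {φ : Formula}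
    (h : ∀ A : Interp, A.IsModel T → ∀ v V, φ.Sat A v V) : Proves T φ := by
  by_contra hφ
  obtain ⟨Δ, hΔ, hmem⟩ := exists_isHenkin (Γ := [neg φ]) hT fun hd => hφ (.byContra hd)
  have h₁ := (hΔ.sat_interp φ .var id).1 (h _ (hΔ.isModel_interp hT) _ _)
  rw [subst_var_id] at h₁
  exact hΔ.falsum_notMem (hΔ.imp_mem_iff.1 (hmem _ List.mem_cons_self) h₁)

end SecondOrder

namespace SecondOrder

open Formula Interp

/-! ### Bounded formulas -/

namespace Formula

/-- Bounded universal quantifier. -/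
def ball (t : Term) (φ : Formula) : Formula := all (imp (lt (.var 0) t.shift) φ)

/-- Bounded existential quantifier. -/
def bex (t : Term) (φ : Formula) : Formula := neg (ball t (neg φ))

@[simp] theorem sat_ball {A : Interp} {v : ℕ → A.Num} {V : ℕ → A.Sets} {φ : Formula} (t : Term) :
    (ball t φ).Sat A v V ↔ ∀ n < t.eval A v, φ.Sat A (cons n v) V := by
  simp [ball]

@[simp] theorem sat_bex {A : Interp} {v : ℕ → A.Num} {V : ℕ → A.Sets} {φ : Formula} (t : Term) :
    (bex t φ).Sat A v V ↔ ∃ n < t.eval A v, φ.Sat A (cons n v) V := by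
  simp [bex]

namespace IsSigma00

variable {φ ψ : Formula}

theorem neg (hφ : IsSigma00 φ) : IsSigma00 φ.neg := hφ.imp .falsum

theorem and (hφ : IsSigma00 φ) (hψ : IsSigma00 ψ) : IsSigma00 (φ.and ψ) := (hφ.imp hψ.neg).neg

theorem or (hφ : IsSigma00 φ) (hψ : IsSigma00 ψ) : IsSigma00 (φ.or ψ) := hφ.neg.imp hψ

theorem le (s t : Term) : IsSigma00 (.le s t) := (lt s t).or (eq s t)

theorem bounded_all (t : Term) (hφ : IsSigma00 φ) : IsSigma00 (.ball t φ) := .ball t hφ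

theorem bounded_ex (t : Term) (hφ : IsSigma00 φ) : IsSigma00 (.bex t φ) :=
  (hφ.neg.bounded_all t).neg

end IsSigma00

end Formula

/-! ### Arithmetic in a model of `RCA₀*` -/

namespace Model

variable {A : Interp}

instance : LE A.Num := ⟨fun a b => a < b ∨ a = b⟩

theorem le_iff_lt_or_eq {a b : A.Num} : a ≤ b ↔ a < b ∨ a = b := Iff.rfl

/-- The code of the ordered pair of `a` and `b`. -/
def pair (a b : A.Num) : A.Num := (a + b) * (a + b) + a

variable [hA : Fact (A.IsModel RCA0Star)]

theorem sigma00_induction {φ : Formula} (hφ : IsSigma00 φ) (v : ℕ → A.Num) (V : ℕ → A.Sets)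
    (h₀ : φ.Sat A (cons 0 v) V)
    (h₁ : ∀ n, φ.Sat A (cons n v) V → φ.Sat A (cons (n + 1) v) V) (n : A.Num) :
    φ.Sat A (cons n v) V := by
  have h := hA.out _ (.induction φ hφ) v V
  simp only [Sat, sat_and, sat_inst, sat_instSucc] at h
  exact h ⟨h₀, h₁⟩ n

/-- Equations contain no set variables, so `someSet` only fills the assignment. -/
theorem eq_induction (s t : Term) (v : ℕ → A.Num) (h₀ : s.eval A (cons 0 v) = t.eval A (cons 0 v))
    (h₁ : ∀ n, s.eval A (cons n v) = t.eval A (cons n v) →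
      s.eval A (cons (n + 1) v) = t.eval A (cons (n + 1) v)) (n : A.Num) :
    s.eval A (cons n v) = t.eval A (cons n v) :=
  sigma00_induction (.eq s t) v (fun _ => A.someSet) h₀ h₁ n

theorem sat_axiom {φ : Formula} (h : RCA0Star φ) (m n : A.Num) :
    φ.Sat A (cons n fun _ => m) fun _ => A.someSet := hA.out φ h _ _

theorem succ_ne_zero (n : A.Num) : n + 1 ≠ 0 := by
  simpa using sat_axiom .succ_ne_zero n n

theorem succ_inj {m n : A.Num} (h : m + 1 = n + 1) : m = n := by
  have := sat_axiom .succ_inj m n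
  simp only [Sat] at this
  exact this h

theorem add_zero (m : A.Num) : m + 0 = m := by
  simpa using sat_axiom .add_zero m m

theorem add_succ (m n : A.Num) : m + (n + 1) = m + n + 1 := by
  simpa using sat_axiom .add_succ m n

theorem mul_zero (m : A.Num) : m * 0 = 0 := by
  simpa using sat_axiom .mul_zero m m

theorem mul_succ (m n : A.Num) : m * (n + 1) = m * n + m := by
  simpa using sat_axiom .mul_succ m n

theorem not_lt_zero (m : A.Num) : ¬ m < 0 := by
  simpa using sat_axiom .not_lt_zero m m

theorem lt_succ {m n : A.Num} : m < n + 1 ↔ m < n ∨ m = n := by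
  simpa using sat_axiom .lt_succ m n

theorem add_assoc (a b c : A.Num) : a + b + c = a + (b + c) := by
  refine eq_induction (.add (.add (.var 1) (.var 2)) (.var 0))
    (.add (.var 1) (.add (.var 2) (.var 0))) (cons a fun _ => b) ?_ (fun n h => ?_) c
  · simp [add_zero]
  · simp at h; simp [add_succ, h]

theorem zero_add (a : A.Num) : 0 + a = a := by
  refine eq_induction (.add .zero (.var 0)) (.var 0) (fun _ => a) ?_ (fun n h => ?_) a
  · simp [add_zero]
  · simp at h; simp [add_succ, h]

theorem succ_add (a b : A.Num) : a + 1 + b = a + b + 1 := by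
  refine eq_induction (.add (.add (.var 1) .one) (.var 0)) (.add (.add (.var 1) (.var 0)) .one)
    (fun _ => a) ?_ (fun n h => ?_) b
  · simp [add_zero]
  · simp at h; simp [add_succ, h]

theorem add_comm (a b : A.Num) : a + b = b + a := by
  refine eq_induction (.add (.var 1) (.var 0)) (.add (.var 0) (.var 1))
    (fun _ => a) ?_ (fun n h => ?_) b
  · simp [add_zero, zero_add]
  · simp at h; simp [add_succ, succ_add, h]

theorem mul_add (a b c : A.Num) : a * (b + c) = a * b + a * c := by
  refine eq_induction (.mul (.var 1) (.add (.var 2) (.var 0)))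
    (.add (.mul (.var 1) (.var 2)) (.mul (.var 1) (.var 0))) (cons a fun _ => b) ?_
    (fun n h => ?_) c
  · simp [add_zero, mul_zero]
  · simp at h; simp only [Term.eval, cons_zero, cons_succ, add_succ, mul_succ, h]
    rw [add_assoc]

theorem zero_mul (a : A.Num) : 0 * a = 0 := by
  refine eq_induction (.mul .zero (.var 0)) .zero (fun _ => a) ?_ (fun n h => ?_) a
  · simp [mul_zero]
  · simp at h; simp [mul_succ, h, add_zero]

theorem succ_mul (a b : A.Num) : (a + 1) * b = a * b + b := by
  refine eq_induction (.mul (.add (.var 1) .one) (.var 0)) (.add (.mul (.var 1) (.var 0)) (.var 0))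
    (fun _ => a) ?_ (fun n h => ?_) b
  · simp [mul_zero, add_zero]
  · simp at h; simp only [Term.eval, cons_zero, cons_succ, mul_succ, h, add_succ]
    rw [add_assoc _ n, add_comm n a, ← add_assoc]

theorem mul_comm (a b : A.Num) : a * b = b * a := by
  refine eq_induction (.mul (.var 1) (.var 0)) (.mul (.var 0) (.var 1))
    (fun _ => a) ?_ (fun n h => ?_) b
  · simp [mul_zero, zero_mul]
  · simp at h; simp [mul_succ, succ_mul, h]

theorem mul_assoc (a b c : A.Num) : a * b * c = a * (b * c) := by
  refine eq_induction (.mul (.mul (.var 1) (.var 2)) (.var 0))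
    (.mul (.var 1) (.mul (.var 2) (.var 0))) (cons a fun _ => b) ?_ (fun n h => ?_) c
  · simp [mul_zero]
  · simp at h; simp only [Term.eval, cons_zero, cons_succ, mul_succ, h]
    rw [mul_add]

theorem mul_one (a : A.Num) : a * 1 = a := by
  rw [← zero_add 1, mul_succ, mul_zero, zero_add]

instance : CommSemiring A.Num where
  add_assoc := add_assoc
  zero_add := zero_add
  add_zero := add_zero
  add_comm := add_comm
  left_distrib := mul_add
  right_distrib a b c := by rw [mul_comm, mul_add, mul_comm c, mul_comm c]
  zero_mul := zero_mul
  mul_zero := mul_zero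
  mul_assoc := mul_assoc
  one_mul a := by rw [mul_comm, mul_one]
  mul_one := mul_one
  mul_comm := mul_comm
  nsmul := nsmulRec

theorem add_right_cancel {a b : A.Num} (c : A.Num) (h : a + c = b + c) : a = b := by
  refine sigma00_induction (φ := imp (.eq (.add (.var 1) (.var 0)) (.add (.var 2) (.var 0)))
    (.eq (.var 1) (.var 2))) (.imp (.eq _ _) (.eq _ _)) (cons a fun _ => b)
    (fun _ => A.someSet) ?_ (fun n ih => ?_) c h
  · simp
  · simp only [Sat, Term.eval, cons_zero, cons_succ, add_succ] at ih ⊢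
    exact fun h => ih (succ_inj h)

theorem lt_add_succ (a c : A.Num) : a < a + c + 1 := by
  refine sigma00_induction (φ := .lt (.var 1) (.add (.add (.var 1) (.var 0)) .one)) (.lt _ _)
    (fun _ => a) (fun _ => A.someSet) ?_ (fun n ih => ?_) c
  · simp [lt_succ]
  · simp only [Sat, Term.eval, cons_zero, cons_succ, ← add_assoc] at ih ⊢
    exact lt_succ.2 (.inl ih)

theorem succ_lt_succ {a b : A.Num} (h : a < b) : a + 1 < b + 1 := by
  refine sigma00_induction (φ := .imp (.lt (.var 1) (.var 0))
    (.lt (.add (.var 1) .one) (.add (.var 0) .one))) (.imp (.lt _ _) (.lt _ _))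
    (fun _ => a) (fun _ => A.someSet) ?_ (fun n ih => ?_) b h
  · simp [not_lt_zero]
  · simp only [Sat, Term.eval, cons_zero, cons_succ, lt_succ] at ih ⊢
    rintro (h | rfl)
    · exact .inl (ih h)
    · exact .inr rfl

/-- The difference is sought below `b`, which keeps the induction formula Σ⁰₀. -/
theorem exists_eq_add_succ {a b : A.Num} (h : a < b) : ∃ c, b = a + c + 1 := by
  have := sigma00_induction (φ := .imp (.lt (.var 1) (.var 0))
    (.bex (.var 0) (.eq (.var 1) (.add (.add (.var 2) (.var 0)) .one))))
    (.imp (.lt _ _) (.bounded_ex _ (.eq _ _)))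
    (fun _ => a) (fun _ => A.someSet) ?_ (fun n ih => ?_) b
  · simp only [Sat, sat_bex, Term.eval, cons_zero, cons_succ] at this
    obtain ⟨c, _, hc⟩ := this h
    exact ⟨c, hc⟩
  · simp [not_lt_zero]
  · simp only [Sat, sat_bex, Term.eval, cons_zero, cons_succ] at ih ⊢
    intro h
    rcases lt_succ.1 h with h | rfl
    · obtain ⟨c, hc, e⟩ := ih h
      exact ⟨c + 1, succ_lt_succ hc, by rw [e]; ring⟩
    · refine ⟨0, ?_, by ring⟩
      have := lt_add_succ 0 a
      rwa [zero_add] at this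

theorem lt_iff_exists {a b : A.Num} : a < b ↔ ∃ c, b = a + c + 1 :=
  ⟨exists_eq_add_succ, fun ⟨c, hc⟩ => hc ▸ lt_add_succ a c⟩

theorem eq_zero_or_succ (a : A.Num) : a = 0 ∨ ∃ c, a = c + 1 := by
  have h : (0 : A.Num) < a + 1 := lt_iff_exists.2 ⟨a, by ring⟩
  rcases lt_succ.1 h with h | h
  · obtain ⟨c, rfl⟩ := lt_iff_exists.1 h
    exact .inr ⟨c, by ring⟩
  · exact .inl h.symm

theorem le_iff_exists {a b : A.Num} : a ≤ b ↔ ∃ c, b = a + c := by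
  rw [le_iff_lt_or_eq, lt_iff_exists]
  constructor
  · rintro (⟨c, rfl⟩ | rfl)
    · exact ⟨c + 1, by ring⟩
    · exact ⟨0, by ring⟩
  · rintro ⟨c, rfl⟩
    rcases eq_zero_or_succ c with rfl | ⟨c, rfl⟩
    · exact .inr (by ring)
    · exact .inl ⟨c, by ring⟩

theorem add_left_cancel {a b : A.Num} (c : A.Num) (h : c + a = c + b) : a = b :=
  add_right_cancel c (by rwa [add_comm a, add_comm b])

theorem not_lt_self (a : A.Num) : ¬ a < a := by
  rw [lt_iff_exists]
  rintro ⟨c, hc⟩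
  refine succ_ne_zero c (add_left_cancel a ?_)
  rw [add_zero, ← add_assoc, ← hc]

theorem lt_trichotomy (a b : A.Num) : a < b ∨ a = b ∨ b < a := by
  have := sigma00_induction (φ := .or (.lt (.var 1) (.var 0))
    (.or (.eq (.var 1) (.var 0)) (.lt (.var 0) (.var 1))))
    (.or (.lt _ _) (.or (.eq _ _) (.lt _ _)))
    (fun _ => a) (fun _ => A.someSet) ?_ (fun n ih => ?_) b
  · simpa using this
  · simp only [Sat, sat_or, Term.eval, cons_zero, cons_succ]
    rcases eq_zero_or_succ a with rfl | ⟨c, rfl⟩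
    · exact .inr (.inl rfl)
    · exact .inr (.inr (lt_iff_exists.2 ⟨c, by ring⟩))
  · simp only [Sat, sat_or, Term.eval, cons_zero, cons_succ] at ih ⊢
    rcases ih with h | rfl | h
    · exact .inl (lt_succ.2 (.inl h))
    · exact .inl (lt_succ.2 (.inr rfl))
    · obtain ⟨c, rfl⟩ := lt_iff_exists.1 h
      rcases eq_zero_or_succ c with rfl | ⟨c, rfl⟩
      · exact .inr (.inl (by ring))
      · exact .inr (.inr (lt_iff_exists.2 ⟨c, by ring⟩))

theorem lt_trans {a b c : A.Num} (h : a < b) (h' : b < c) : a < c := by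
  obtain ⟨d, rfl⟩ := lt_iff_exists.1 h
  obtain ⟨e, rfl⟩ := lt_iff_exists.1 h'
  exact lt_iff_exists.2 ⟨d + 1 + e, by ring⟩

noncomputable instance : LinearOrder A.Num where
  le_refl a := .inr rfl
  le_trans a b c hab hbc := by
    obtain ⟨d, rfl⟩ := le_iff_exists.1 hab
    obtain ⟨e, rfl⟩ := le_iff_exists.1 hbc
    exact le_iff_exists.2 ⟨d + e, by ring⟩
  lt_iff_le_not_ge a b := by
    constructor
    · refine fun h => ⟨.inl h, ?_⟩
      rintro (h' | rfl)
      · exact not_lt_self a (lt_trans h h')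
      · exact not_lt_self b h
    · rintro ⟨h | rfl, h'⟩
      · exact h
      · exact (h' (.inr rfl)).elim
  le_antisymm a b h h' := by
    rcases h with h | h
    · rcases h' with h' | h'
      · exact (not_lt_self a (lt_trans h h')).elim
      · exact h'.symm
    · exact h
  le_total a b := by
    rcases lt_trichotomy a b with h | h | h
    · exact .inl (.inl h)
    · exact .inl (.inr h)
    · exact .inr (.inl h)
  toDecidableLE := Classical.decRel _

theorem lt_succ_iff {a b : A.Num} : a < b + 1 ↔ a ≤ b := lt_succ

theorem le_add_right (a b : A.Num) : a ≤ a + b := le_iff_exists.2 ⟨b, rfl⟩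

theorem le_add_left (a b : A.Num) : a ≤ b + a := le_iff_exists.2 ⟨b, add_comm b a⟩

theorem le_mul_self (a : A.Num) : a ≤ a * a := by
  rcases eq_zero_or_succ a with rfl | ⟨c, rfl⟩
  · exact .inr (by ring)
  · exact le_iff_exists.2 ⟨c * c + c, by ring⟩

theorem left_le_pair (a b : A.Num) : a ≤ pair a b := le_add_left _ _

theorem right_le_pair (a b : A.Num) : b ≤ pair a b :=
  ((le_add_left b a).trans (le_mul_self _)).trans (le_add_right _ _)

theorem pair_lt_pair {a b a' b' : A.Num} (h : a + b < a' + b') : pair a b < pair a' b' := by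
  obtain ⟨c, hc⟩ := lt_iff_exists.1 h
  -- With s = a + b this is (s + c + 1)² + a' − s² − a − 1, written without subtraction.
  refine lt_iff_exists.2 ⟨b + c * c + 2 * c + 2 * c * (a + b) + a + b + a', ?_⟩
  rw [pair, pair, hc]
  ring

theorem pair_inj {a b a' b' : A.Num} (h : pair a b = pair a' b') : a = a' ∧ b = b' := by
  rcases lt_trichotomy (a + b) (a' + b') with h' | h' | h'
  · exact absurd h (pair_lt_pair h').ne
  · have : a = a' := by
      rw [pair, pair, h'] at h
      exact add_left_cancel _ h
    subst this
    exact ⟨rfl, add_left_cancel _ h'⟩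
  · exact absurd h (pair_lt_pair h').ne'

/-- The least number principle for `Σ⁰₀` formulas. -/
theorem exists_least {φ : Formula} (hφ : IsSigma00 φ) (v : ℕ → A.Num) (V : ℕ → A.Sets)
    {n : A.Num} (hn : φ.Sat A (cons n v) V) :
    ∃ m, φ.Sat A (cons m v) V ∧ ∀ i < m, ¬ φ.Sat A (cons i v) V := by
  by_contra! h
  -- Induction on "no `i` below `n` satisfies `φ`". The parameters of `φ` skip two variables, the
  -- bounded `i` and the induction variable `n`.
  have key := sigma00_induction (φ := .ball (.var 0)
    (.neg (φ.subst (consTerm (.var 0) fun i => .var (i + 2)) id)))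
    (.bounded_all _ (hφ.subst _ _).neg) v V
  have e : ∀ a b, (φ.subst (consTerm (.var 0) fun i => .var (i + 2)) id).Sat A
      (cons a (cons b v)) V ↔ φ.Sat A (cons a v) V := by
    intro a b
    rw [sat_subst]
    refine iff_of_eq ?_
    congr 1
    funext i
    cases i <;> rfl
  simp only [sat_ball, sat_neg, e, Term.eval, cons_zero] at key
  refine key (fun i hi => (not_lt_zero i hi).elim) (fun m hm i hi hs => ?_) (n + 1) n
    (lt_succ_iff.2 le_rfl) hn
  obtain ⟨j, hj, hj'⟩ := h i hs
  exact hm j (hj.trans_le (lt_succ_iff.1 hi)) hj'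

/-- Comprehension for `Σ⁰₀` formulas. -/
theorem exists_set {φ : Formula} (hφ : IsSigma00 φ) (v : ℕ → A.Num) (V : ℕ → A.Sets) :
    ∃ X : A.Sets, ∀ n, n ∈ X ↔ φ.Sat A (cons n v) V := by
  -- A vacuous quantifier makes `φ` both Σ⁰₁ and Π⁰₁.
  have h := hA.out _ (.comprehension φ.shift φ.shift (hφ.subst _ _) (hφ.subst _ _)) v V
  simp only [Sat, sat_iff, sat_ex, sat_exSet, sat_shift, sat_shiftSet, Term.eval, cons_zero] at h
  simpa using h fun n => ⟨fun ⟨_, h⟩ _ => h, fun h => ⟨0, h 0⟩⟩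

end Model

end SecondOrder

/-! ### From ERT to minERT inside a model of `RCA0Star` -/

namespace SecondOrder

open Formula Interp

namespace Model

variable {A : Interp}

theorem eval_pairTerm (v : ℕ → A.Num) (s t : Term) :
    (pairTerm s t).eval A v = pair (s.eval A v) (t.eval A v) := rfl

/-- The formula `IsFirst f b i`, where `f` is set variable `0`. -/
def isFirstFormula (b k i : Term) : Formula :=
  (le b i).and (ball i ((le b.shift (.var 0)).imp (ball k.shift (Formula.neg
    ((mem (pairTerm (.var 1) (.var 0)) 0).and
      (mem (pairTerm i.shift.shift (.var 0)) 0))))))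

theorem isSigma00_isFirstFormula (b k i : Term) : IsSigma00 (isFirstFormula b k i) :=
  (IsSigma00.le _ _).and (.bounded_all _ ((IsSigma00.le _ _).imp
    (.bounded_all _ ((IsSigma00.mem _ _).and (.mem _ _)).neg)))

variable [hA : Fact (A.IsModel RCA0Star)]

/-- `X` is the graph of the coloring `f` with `k` colors. -/
def IsGraph (X : A.Sets) (f : A.Num → A.Num) (k : A.Num) : Prop :=
  (∀ i, f i < k) ∧ ∀ z, z ∈ X ↔ ∃ i, z = pair i (f i)

/-- `b` is a bound for the coloring `f`. -/
def IsBoundFor (f : A.Num → A.Num) (b : A.Num) : Prop :=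
  ∀ x, b ≤ x → ∃ y, b ≤ y ∧ x ≠ y ∧ f x = f y

theorem IsGraph.pair_mem {X : A.Sets} {f : A.Num → A.Num} {k : A.Num} (h : IsGraph X f k)
    {i j : A.Num} : pair i j ∈ X ↔ j = f i := by
  rw [h.2]
  constructor
  · rintro ⟨i', e⟩
    obtain ⟨rfl, rfl⟩ := pair_inj e
    rfl
  · rintro rfl
    exact ⟨i, rfl⟩

/-- The function is chosen outside the model; only its graph has to be a set of the model. -/
theorem sat_isColoring {v : ℕ → A.Num} {V : ℕ → A.Sets} (F : ℕ) (k : Term) :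
    (isColoring F k).Sat A v V ↔ ∃ f, IsGraph (V F) f (k.eval A v) := by
  simp only [isColoring, Sat, sat_and, sat_ex, eval_pairTerm, Term.eval, Term.eval_shift, cons_zero,
    cons_succ]
  constructor
  · rintro ⟨h₁, h₂⟩
    choose f hf hf' using h₂
    refine ⟨f, fun i => (hf i).1, fun z => ⟨fun hz => ?_, ?_⟩⟩
    · obtain ⟨i, j, hj, rfl⟩ := h₁ z hz
      exact ⟨i, by rw [hf' i j ⟨hj, hz⟩]⟩
    · rintro ⟨i, rfl⟩
      exact (hf i).2
  · rintro ⟨f, hf⟩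
    refine ⟨fun z hz => ?_, fun i => ⟨f i, ⟨hf.1 i, hf.pair_mem.2 rfl⟩, fun j hj =>
      hf.pair_mem.1 hj.2⟩⟩
    obtain ⟨i, rfl⟩ := (hf.2 z).1 hz
    exact ⟨i, f i, hf.1 i, rfl⟩

theorem sat_isBound {v : ℕ → A.Num} {V : ℕ → A.Sets} {F : ℕ} {f : A.Num → A.Num} {k : A.Num}
    (hf : IsGraph (V F) f k) (b : Term) :
    (isBound F b).Sat A v V ↔ IsBoundFor f (b.eval A v) := by
  simp only [isBound, Sat, sat_and, sat_ex, sat_neg, sat_le, eval_pairTerm, Term.eval,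
    Term.eval_shift, cons_zero, cons_succ, hf.pair_mem, ← le_iff_lt_or_eq, exists_eq_left]
  rfl

theorem sat_ERT {v : ℕ → A.Num} {V : ℕ → A.Sets} :
    ERT.Sat A v V ↔ ∀ (X : A.Sets) (f : A.Num → A.Num) (k : A.Num), IsGraph X f k →
      ∃ b, IsBoundFor f b := by
  simp only [ERT, Sat, sat_isColoring, sat_ex, cons_zero, Term.eval]
  refine forall_congr' fun X => ⟨fun h f k hf => ?_, fun h k ⟨f, hf⟩ => ?_⟩
  · obtain ⟨b, hb⟩ := h k ⟨f, hf⟩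
    exact ⟨b, (sat_isBound hf _).1 hb⟩
  · obtain ⟨b, hb⟩ := h f k hf
    exact ⟨b, (sat_isBound hf _).2 hb⟩

theorem sat_minERT {v : ℕ → A.Num} {V : ℕ → A.Sets} :
    minERT.Sat A v V ↔ ∀ (X : A.Sets) (f : A.Num → A.Num) (k : A.Num), IsGraph X f k →
      ∃ b, IsLeast {b | IsBoundFor f b} b := by
  simp only [minERT, Sat, sat_isColoring, sat_ex, sat_and, sat_le, cons_zero, cons_succ, Term.eval,
    ← le_iff_lt_or_eq]
  refine forall_congr' fun X => ⟨fun h f k hf => ?_, fun h k ⟨f, hf⟩ => ?_⟩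
  · obtain ⟨b, hb, hb'⟩ := h k ⟨f, hf⟩
    exact ⟨b, (sat_isBound hf _).1 hb, fun c hc => hb' c ((sat_isBound hf _).2 hc)⟩
  · obtain ⟨b, hb, hb'⟩ := h f k hf
    exact ⟨b, (sat_isBound hf _).2 hb, fun c hc => hb' ((sat_isBound hf _).1 hc)⟩

/-- The color of `i` has not occurred in the interval from `b` to `i`. -/
def IsFirst (f : A.Num → A.Num) (b i : A.Num) : Prop := b ≤ i ∧ ∀ x < i, b ≤ x → f x ≠ f i

theorem sat_isFirstFormula {v : ℕ → A.Num} {V : ℕ → A.Sets} {f : A.Num → A.Num} {k : Term}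
    (hf : IsGraph (V 0) f (k.eval A v)) (b i : Term) :
    (isFirstFormula b k i).Sat A v V ↔ IsFirst f (b.eval A v) (i.eval A v) := by
  simp only [isFirstFormula, Sat, sat_and, sat_ball, sat_neg, sat_le, eval_pairTerm, Term.eval,
    Term.eval_shift, cons_zero, cons_succ, hf.pair_mem, ← le_iff_lt_or_eq, IsFirst]
  refine and_congr_right fun _ => forall₃_congr fun x _ _ => ?_
  exact ⟨fun h e => h (f x) (hf.1 x) ⟨rfl, e⟩, fun h c _ ⟨e, e'⟩ => h (e.symm.trans e')⟩

/-- The coloring that keeps the color of every first occurrence after `b` and sends all other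
numbers to the new color `k`. -/
theorem exists_graph_isFirst {X : A.Sets} {f : A.Num → A.Num} {k : A.Num} (hf : IsGraph X f k)
    (b : A.Num) : ∃ (Y : A.Sets) (g : A.Num → A.Num), IsGraph Y g (k + 1) ∧
      (∀ i, IsFirst f b i → g i = f i) ∧ ∀ i, ¬ IsFirst f b i → g i = k := by
  classical
  let first := isFirstFormula (.var 3) (.var 4) (.var 1)
  -- Both components of a pair are at most its code `z`, so searching below `z + 1` suffices and the
  -- definition is Σ⁰₀. In the innermost scope, variables 0 to 4 are the color, the argument, `z`,
  -- `b` and `k`.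
  obtain ⟨Y, hY⟩ := exists_set
    (φ := bex (.add (.var 0) .one) (bex (.add (.var 1) .one)
      ((Formula.eq (.var 2) (pairTerm (.var 1) (.var 0))).and
        ((first.and (mem (pairTerm (.var 1) (.var 0)) 0)).or
          (first.neg.and (.eq (.var 0) (.var 4)))))))
    (.bounded_ex _ (.bounded_ex _ ((IsSigma00.eq _ _).and
      (((isSigma00_isFirstFormula _ _ _).and (.mem _ _)).or
        ((isSigma00_isFirstFormula _ _ _).neg.and (.eq _ _))))))
    (cons b fun _ => k) fun _ => X
  have hfirst : ∀ z i j, first.Sat A (cons j (cons i (cons z (cons b fun _ => k)))) (fun _ => X) ↔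
      IsFirst f b i := fun z i j => sat_isFirstFormula (k := .var 4) hf _ _
  simp only [Sat, sat_and, sat_or, sat_bex, sat_neg, eval_pairTerm, Term.eval, cons_zero, cons_succ,
    hf.pair_mem, hfirst, lt_succ_iff] at hY
  refine ⟨Y, fun i => if IsFirst f b i then f i else k, ⟨fun i => ?_, fun z => ?_⟩,
    fun i hi => if_pos hi, fun i hi => if_neg hi⟩
  · rw [lt_succ_iff]
    dsimp only
    split_ifs
    · exact (hf.1 i).le
    · exact le_rfl
  · rw [hY]
    constructor
    · rintro ⟨i, _, j, _, rfl, ⟨hi, rfl⟩ | ⟨hi, rfl⟩⟩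
      · exact ⟨i, by simp [hi]⟩
      · exact ⟨i, by simp [hi]⟩
    · rintro ⟨i, rfl⟩
      refine ⟨i, left_le_pair _ _, _, right_le_pair i _, rfl, ?_⟩
      by_cases hi : IsFirst f b i
      · exact .inl ⟨hi, by simp [hi]⟩
      · exact .inr ⟨hi, by simp [hi]⟩

/-- Least number principle for "`x ≥ b` has the color of `y`", with that color as a parameter. -/
theorem exists_isFirst {X : A.Sets} {f : A.Num → A.Num} {k : A.Num} (hf : IsGraph X f k)
    {b y : A.Num} (hy : b ≤ y) : ∃ x, IsFirst f b x ∧ f x = f y := by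
  obtain ⟨x, hx, hmin⟩ := exists_least
    (φ := (le (.var 1) (.var 0)).and (mem (pairTerm (.var 0) (.var 2)) 0))
    ((IsSigma00.le _ _).and (.mem _ _)) (cons b fun _ => f y) (fun _ => X) (n := y) (by
      simp only [Sat, sat_and, sat_le, eval_pairTerm, Term.eval, cons_zero, cons_succ, hf.pair_mem,
        ← le_iff_lt_or_eq]
      exact ⟨hy, trivial⟩)
  simp only [Sat, sat_and, sat_le, eval_pairTerm, Term.eval, cons_zero, cons_succ, hf.pair_mem,
    ← le_iff_lt_or_eq] at hx hmin
  exact ⟨x, ⟨hx.1, fun i hi hb e => hmin i hi ⟨hb, hx.2.trans e.symm⟩⟩, hx.2.symm⟩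

/-- If every color that occurs after the bound `b` does so before `d`, then there is a least
bound. -/
theorem exists_isLeast {X : A.Sets} {f : A.Num → A.Num} {k : A.Num} (hf : IsGraph X f k)
    {b d : A.Num} (hb : IsBoundFor f b) (hd : ∀ y, b ≤ y → ∃ x, b ≤ x ∧ x < d ∧ f x = f y)
    (hbd : b ≤ d) : ∃ c, IsLeast {c | IsBoundFor f c} c := by
  -- Minimize `c` such that each `x` with `c ≤ x < b` has a partner `y` with `c ≤ y < d`. Common
  -- colors are sought below `k`, so everything is bounded, and `b` qualifies vacuously.
  obtain ⟨c, hc, hmin⟩ := exists_least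
    (φ := ball (.var 1) ((le (.var 1) (.var 0)).imp (bex (.var 3) ((le (.var 2) (.var 0)).and
      ((Formula.eq (.var 1) (.var 0)).neg.and (bex (.var 5)
        ((mem (pairTerm (.var 2) (.var 0)) 0).and (mem (pairTerm (.var 1) (.var 0)) 0))))))))
    (.bounded_all _ ((IsSigma00.le _ _).imp (.bounded_ex _ ((IsSigma00.le _ _).and
      ((IsSigma00.eq _ _).neg.and (.bounded_ex _ ((IsSigma00.mem _ _).and (.mem _ _))))))))
    (cons b (cons d fun _ => k)) (fun _ => X) (n := b) (by
      simp only [Sat, sat_ball, sat_le, Term.eval, cons_zero, cons_succ, ← le_iff_lt_or_eq]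
      exact fun x hx hx' => absurd hx hx'.not_gt)
  have hbex : ∀ x y, (∃ e < k, e = f x ∧ e = f y) ↔ f x = f y := fun x y =>
    ⟨fun ⟨_, _, h, h'⟩ => h.symm.trans h', fun h => ⟨f x, hf.1 x, rfl, h⟩⟩
  simp only [Sat, sat_ball, sat_bex, sat_and, sat_neg, sat_le, eval_pairTerm, Term.eval, cons_zero,
    cons_succ, hf.pair_mem, ← le_iff_lt_or_eq, hbex] at hc hmin
  -- A true bound below `c` would satisfy the bounded condition: a partner `y ≥ b` can be replaced
  -- by some `z` of the same color in `[b, d)`, and `z` differs from `x` because `x < b`.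
  have key : ∀ c', IsBoundFor f c' → c ≤ c' := fun c' hc' => by
    by_contra! hlt
    refine hmin c' hlt fun x hx hx' => ?_
    obtain ⟨y, hy, hne, e⟩ := hc' x hx'
    by_cases hyb : y < b
    · exact ⟨y, hyb.trans_le hbd, hy, hne, e⟩
    · obtain ⟨z, hz, hzd, e'⟩ := hd y (not_lt.1 hyb)
      exact ⟨z, hzd, (hx'.trans hx.le).trans hz, (hx.trans_le hz).ne, e.trans e'.symm⟩
  refine ⟨c, fun x hx => ?_, key⟩
  by_cases hxb : x < b
  · obtain ⟨y, _, hy⟩ := hc x hxb hx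
    exact ⟨y, hy⟩
  · obtain ⟨y, hy, h⟩ := hb x (not_lt.1 hxb)
    exact ⟨y, (key b hb).trans hy, h⟩

theorem sat_ERT_iff_sat_minERT {v : ℕ → A.Num} {V : ℕ → A.Sets} :
    ERT.Sat A v V ↔ minERT.Sat A v V := by
  rw [sat_ERT, sat_minERT]
  refine ⟨fun h X f k hf => ?_, fun h X f k hf => (h X f k hf).imp fun b hb => hb.1⟩
  obtain ⟨b, hb⟩ := h X f k hf
  obtain ⟨Y, g, hg, hfirst, hother⟩ := exists_graph_isFirst hf b
  -- The second use of ERT plays the role of a bounding principle for the first occurrences.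
  obtain ⟨d, hd⟩ := h Y g _ hg
  refine exists_isLeast hf hb (d := max b d) (fun y hy => ?_) (le_max_left _ _)
  obtain ⟨x, hx, e⟩ := exists_isFirst hf hy
  refine ⟨x, hx.1, lt_max_of_lt_right ?_, e⟩
  by_contra! hdx
  -- A first occurrence `x ≥ d` would share its new color with some `z ≠ x`. That color is below
  -- `k`, so `z` is also a first occurrence of the same old color, which is impossible.
  obtain ⟨z, hz, hne, e'⟩ := hd x hdx
  have hz' : IsFirst f b z := by
    by_contra hz'
    rw [hfirst x hx, hother z hz'] at e'
    exact (hf.1 x).ne e'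
  rw [hfirst x hx, hfirst z hz'] at e'
  rcases lt_or_gt_of_ne hne with h | h
  · exact hz'.2 x h hx.1 e'
  · exact hx.2 z h hz'.1 e'.symm

end Model

theorem proves_ERT_iff_minERT : Proves RCA0Star (Formula.iff ERT minERT) :=
  proves_of_forall_sat substClosed_RCA0Star fun A hA v V => by
    have : Fact (A.IsModel RCA0Star) := ⟨hA⟩
    exact sat_iff.2 Model.sat_ERT_iff_sat_minERT

end SecondOrder

namespace Weihrauch

/-! ### Bounds for finite colorings -/

/-- Every entry of `l` occurs at least twice in `l`. -/
def Repeats (l : List ℕ) : Prop := ∀ a ∈ l, 2 ≤ l.count a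

instance (l : List ℕ) : Decidable (Repeats l) :=
  inferInstanceAs (Decidable (∀ a ∈ l, 2 ≤ l.count a))

/-- The least bound for a finite coloring. -/
def leastBound : List ℕ → ℕ
  | [] => 0
  | a :: l => if Repeats (a :: l) then 0 else leastBound l + 1

theorem leastBound_of_repeats {l : List ℕ} (h : Repeats l) : leastBound l = 0 := by
  cases l with
  | nil => rfl
  | cons a l => exact if_pos h

theorem repeats_drop_leastBound (l : List ℕ) : Repeats (l.drop (leastBound l)) := by
  induction l with
  | nil => simp [Repeats]
  | cons a l ih => rw [leastBound]; split_ifs with h <;> simpa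

theorem leastBound_le {l : List ℕ} {c : ℕ} (h : Repeats (l.drop c)) : leastBound l ≤ c := by
  induction l generalizing c with
  | nil => exact Nat.zero_le c
  | cons a l ih =>
    cases c with
    | zero => exact (leastBound_of_repeats h).le
    | succ c =>
      rw [leastBound]
      split_ifs
      · exact Nat.zero_le _
      · exact Nat.succ_le_succ (ih h)

/-- No bound can leave an unrepeated entry in the remaining list, so all bounds lie past it, and
beyond it the problem is the same one for the tail. -/
theorem leastBound_append_cons {x : ℕ} (l₁ l₂ : List ℕ) (h : (l₁ ++ x :: l₂).count x < 2) :
    leastBound (l₁ ++ x :: l₂) = l₁.length + 1 + leastBound l₂ := by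
  have hn : ¬ Repeats (l₁ ++ x :: l₂) := fun hr => (hr x (by simp)).not_gt h
  induction l₁ with
  | nil => simp only [List.nil_append] at hn ⊢; rw [leastBound, if_neg hn]; simp [add_comm]
  | cons y l₁ ih =>
    have h' : (l₁ ++ x :: l₂).count x < 2 :=
      ((List.sublist_cons_self y _).count_le x).trans_lt h
    rw [List.cons_append] at hn ⊢
    rw [leastBound, if_neg hn, ih h' fun hr => (hr x (by simp)).not_gt h']
    simp; ring

/-- The part of a finite coloring after the first color that occurs only once. -/
def afterSingle (l : List ℕ) : List ℕ := (l.dropWhile fun a => 2 ≤ l.count a).tail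

theorem afterSingle_cases (l : List ℕ) :
    Repeats l ∧ afterSingle l = [] ∨
      ∃ l₁ x, l = l₁ ++ x :: afterSingle l ∧ l.count x < 2 := by
  have happ := List.takeWhile_append_dropWhile (p := fun a => decide (2 ≤ l.count a)) (l := l)
  cases h : l.dropWhile fun a => decide (2 ≤ l.count a) with
  | nil =>
    refine .inl ⟨fun a ha => ?_, by rw [afterSingle, h]; rfl⟩
    simpa using List.dropWhile_eq_nil_iff.1 h a ha
  | cons x t =>
    refine .inr ⟨_, x, by rw [afterSingle, h, List.tail_cons, ← h]; exact happ.symm, ?_⟩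
    have := List.head?_dropWhile_not (fun a => decide (2 ≤ l.count a)) l
    rw [h] at this
    simpa using this

/-- The number of colors plus the number of colors that occur at least twice. -/
def weight (l : List ℕ) : ℕ :=
  l.toFinset.card + (l.toFinset.filter fun a => 2 ≤ l.count a).card

theorem weight_le (l : List ℕ) : weight l ≤ 2 * l.toFinset.card := by
  have := Finset.card_filter_le l.toFinset fun a => 2 ≤ l.count a
  rw [weight]; omega

/-- Both sets counted by `weight` can only grow. If neither does, `a` is neither a new color nor a
second occurrence. -/
theorem weight_append_cases (l : List ℕ) (a : ℕ) :
    weight l < weight (l ++ [a]) ∨ weight l = weight (l ++ [a]) ∧ 2 ≤ l.count a := by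
  have h₁ : l.toFinset ⊆ (l ++ [a]).toFinset := fun x hx => by simp_all
  have h₂ : (l.toFinset.filter fun x => 2 ≤ l.count x) ⊆
      ((l ++ [a]).toFinset.filter fun x => 2 ≤ (l ++ [a]).count x) := fun x hx => by
    rw [Finset.mem_filter] at hx ⊢
    exact ⟨h₁ hx.1, hx.2.trans ((List.sublist_append_left l [a]).count_le x)⟩
  have c₁ := Finset.card_le_card h₁
  have c₂ := Finset.card_le_card h₂
  rcases (Nat.add_le_add c₁ c₂).lt_or_eq with h | h
  · exact .inl h
  · refine .inr ⟨h, ?_⟩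
    have e₁ := Finset.eq_of_subset_of_card_le h₁ (by omega)
    have e₂ := Finset.eq_of_subset_of_card_le h₂ (by omega)
    have ha : a ∈ l := by
      rw [← List.mem_toFinset, e₁]; simp
    have : a ∈ (l ++ [a]).toFinset.filter fun x => 2 ≤ (l ++ [a]).count x := by
      rw [Finset.mem_filter]
      refine ⟨by simp, ?_⟩
      have := List.count_pos_iff.2 ha
      simp; omega
    rw [← e₂, Finset.mem_filter] at this
    exact this.2

/-- Only the count of `a` changes, and it was already at least two. The same colors remain single,
and the list is cut at the same place. -/
theorem afterSingle_append {l : List ℕ} {a : ℕ} (ha : 2 ≤ l.count a) :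
    Repeats l ∧ Repeats (l ++ [a]) ∧ afterSingle l = [] ∧ afterSingle (l ++ [a]) = [] ∨
      ∃ l₁ x, x ≠ a ∧ l.count x < 2 ∧ (l ++ [a]).count x < 2 ∧ l = l₁ ++ x :: afterSingle l ∧
        afterSingle (l ++ [a]) = afterSingle l ++ [a] := by
  have hc : ∀ x, 2 ≤ (l ++ [a]).count x ↔ 2 ≤ l.count x := fun x => by
    rcases eq_or_ne x a with rfl | hx
    · have : (l ++ [x]).count x = l.count x + 1 := by simp
      omega
    · simp [List.count_append, hx.symm]
  have hdrop : (l ++ [a]).dropWhile (fun x => 2 ≤ (l ++ [a]).count x) =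
      if (l.dropWhile fun x => 2 ≤ l.count x).isEmpty then []
      else (l.dropWhile fun x => 2 ≤ l.count x) ++ [a] := by
    simp only [hc]
    rw [List.dropWhile_append]
    congr 1
    simp [ha]
  cases h : l.dropWhile fun x => decide (2 ≤ l.count x) with
  | nil =>
    have hr : Repeats l := fun x hx => by simpa using List.dropWhile_eq_nil_iff.1 h x hx
    refine .inl ⟨hr, fun x hx => (hc x).2 ?_, by rw [afterSingle, h]; rfl, ?_⟩
    · rcases List.mem_append.1 hx with hx | hx
      · exact hr x hx
      · rwa [List.mem_singleton.1 hx]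
    · rw [afterSingle, hdrop, h]; rfl
  | cons y t =>
    rcases afterSingle_cases l with ⟨hr, _⟩ | ⟨l₁, x, e, hx⟩
    · have := List.dropWhile_eq_nil_iff.2
        (show ∀ x ∈ l, decide (2 ≤ l.count x) = true from
          fun x hx => decide_eq_true (hr x hx))
      simp [this] at h
    · refine .inr ⟨l₁, x, ?_, hx, ?_, e, ?_⟩
      · rintro rfl; omega
      · have := hc x; omega
      · rw [afterSingle, afterSingle, hdrop, h]; rfl

/-- A number with base `2 k + 1` digits the weights of the parts of `l` between successive colors
that occur only once. -/
def potential (k : ℕ) : ℕ → List ℕ → ℕ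
  | 0, _ => 0
  | j + 1, l => weight l * (2 * k + 1) ^ j + potential k j (afterSingle l)

theorem afterSingle_subset (l : List ℕ) : afterSingle l ⊆ l :=
  ((List.tail_sublist _).trans (List.dropWhile_sublist _)).subset

theorem card_le_of_lt {k : ℕ} {l : List ℕ} (h : ∀ a ∈ l, a < k) : l.toFinset.card ≤ k := by
  simpa using Finset.card_le_card (t := Finset.range k) fun a ha =>
    Finset.mem_range.2 (h a (List.mem_toFinset.1 ha))

/-- Each of the `j` digits is at most `2 * k`, a legitimate digit in base `2 * k + 1`. -/
theorem potential_lt {k : ℕ} (j : ℕ) {l : List ℕ} (h : ∀ a ∈ l, a < k) :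
    potential k j l < (2 * k + 1) ^ j := by
  induction j generalizing l with
  | zero => simp [potential]
  | succ j ih =>
    have h₁ := ih fun a ha => h a (afterSingle_subset l ha)
    have h₂ : weight l ≤ 2 * k := (weight_le l).trans (Nat.mul_le_mul_left 2 (card_le_of_lt h))
    have h₃ := Nat.mul_le_mul_right ((2 * k + 1) ^ j) h₂
    rw [potential, pow_succ']
    linarith

/-- Every change of the least bound increases the potential. -/
theorem potential_append {k : ℕ} (j : ℕ) {l : List ℕ} {a : ℕ} (h : ∀ b ∈ l ++ [a], b < k)
    (hj : (l ++ [a]).toFinset.card ≤ j) :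
    potential k j l < potential k j (l ++ [a]) ∨
      potential k j l = potential k j (l ++ [a]) ∧ leastBound l = leastBound (l ++ [a]) := by
  induction j generalizing l with
  | zero => simp at hj
  | succ j ih =>
    have hl : ∀ b ∈ l, b < k := fun b hb => h b (List.mem_append_left _ hb)
    rw [potential, potential]
    rcases weight_append_cases l a with hw | ⟨hw, ha⟩
    · left
      have h₁ := potential_lt j fun b hb => hl b (afterSingle_subset l hb)
      -- A gain of one in the leading digit outweighs any loss in the lower digits, by
      -- `potential_lt`.
      have h₂ := Nat.mul_le_mul_right ((2 * k + 1) ^ j) (Nat.succ_le_of_lt hw)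
      rw [Nat.succ_mul] at h₂
      omega
    · rw [hw]
      rcases afterSingle_append ha with ⟨hr, hr', e, e'⟩ | ⟨l₁, x, hxa, hx, hx', e, e'⟩
      · rw [e, e', leastBound_of_repeats hr, leastBound_of_repeats hr']
        exact .inr ⟨rfl, rfl⟩
      · have hsub : afterSingle l ++ [a] ⊆ l ++ [a] := fun b hb => by
          rcases List.mem_append.1 hb with hb | hb
          · exact List.mem_append_left _ (afterSingle_subset l hb)
          · exact List.mem_append_right _ hb
        have hx₁ : x ∉ afterSingle l ++ [a] := fun hm => by
          rcases List.mem_append.1 hm with hm | hm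
          · have := List.count_pos_iff.2 hm
            rw [e] at hx
            simp at hx
            omega
          · exact hxa (List.mem_singleton.1 hm)
        -- The single color `x` is missing from the tail, so one digit fewer suffices there and the
        -- induction hypothesis applies.
        have hcard : (afterSingle l ++ [a]).toFinset.card < (l ++ [a]).toFinset.card := by
          refine Finset.card_lt_card ⟨fun b hb => ?_, fun hs => hx₁ ?_⟩
          · exact List.mem_toFinset.2 (hsub (List.mem_toFinset.1 hb))
          · refine List.mem_toFinset.1 (hs (List.mem_toFinset.2 (List.mem_append_left _ ?_)))
            rw [e]; simp
        have e₁ : leastBound l = l₁.length + 1 + leastBound (afterSingle l) := by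
          have := leastBound_append_cons (x := x) l₁ (afterSingle l) (by rwa [← e])
          rwa [← e] at this
        have e₂ : leastBound (l ++ [a]) = l₁.length + 1 + leastBound (afterSingle l ++ [a]) := by
          have e₃ : l ++ [a] = l₁ ++ x :: (afterSingle l ++ [a]) := by
            conv_lhs => rw [e]
            simp
          rw [e₃] at hx' ⊢
          exact leastBound_append_cons l₁ _ hx'
        rw [e', e₁, e₂]
        rcases ih (fun b hb => h b (hsub hb)) (by omega) with h | ⟨h, h'⟩
        · exact .inl (by omega)
        · exact .inr ⟨by omega, by omega⟩

/-! ### Approximations to the least bound -/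

/-- The first `n` values of `f`. -/
def initialSegment (f : ℕ → ℕ) (n : ℕ) : List ℕ := (List.range n).map f

theorem initialSegment_succ (f : ℕ → ℕ) (n : ℕ) :
    initialSegment f (n + 1) = initialSegment f n ++ [f n] := by
  simp [initialSegment, List.range_succ]

theorem repeats_drop_initialSegment {f : ℕ → ℕ} {n c : ℕ} :
    Repeats ((initialSegment f n).drop c) ↔
      ∀ x, c ≤ x → x < n → ∃ y, c ≤ y ∧ y < n ∧ x ≠ y ∧ f x = f y := by
  have hget : ∀ i (h : i < ((initialSegment f n).drop c).length),
      ((initialSegment f n).drop c)[i] = f (c + i) := fun i h => by simp [initialSegment]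
  have hlen : ((initialSegment f n).drop c).length = n - c := by simp [initialSegment]
  simp only [Repeats, ← List.duplicate_iff_two_le_count, List.duplicate_iff_exists_distinct_get,
    List.get_eq_getElem, hget]
  constructor
  · intro h x hcx hxn
    have hx : x - c < ((initialSegment f n).drop c).length := by omega
    have hmem : f x ∈ (initialSegment f n).drop c := by
      have := List.getElem_mem hx
      rwa [hget, Nat.add_sub_cancel' hcx] at this
    obtain ⟨⟨i, hi⟩, ⟨j, hj⟩, hij, e, e'⟩ := h _ hmem
    simp only [Fin.mk_lt_mk] at hij e e'
    by_cases hxi : x = c + i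
    · exact ⟨c + j, by omega, by omega, by omega, e'⟩
    · exact ⟨c + i, by omega, by omega, hxi, e⟩
  · intro h a ha
    obtain ⟨i, hi, rfl⟩ := List.getElem_of_mem ha
    rw [hget]
    obtain ⟨y, hcy, hyn, hne, e⟩ := h (c + i) (by omega) (by omega)
    rcases lt_or_gt_of_ne hne with hlt | hlt
    · exact ⟨⟨i, hi⟩, ⟨y - c, by omega⟩, by rw [Fin.mk_lt_mk]; omega, rfl,
        by rw [e, Nat.add_sub_cancel' hcy]⟩
    · exact ⟨⟨y - c, by omega⟩, ⟨i, hi⟩, by rw [Fin.mk_lt_mk]; omega,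
        by rw [e, Nat.add_sub_cancel' hcy], rfl⟩

/-- The least bound for the first `n` values of `f`. -/
def approxBound (f : ℕ → ℕ) (n : ℕ) : ℕ := leastBound (initialSegment f n)

/-- The limit is a bound because it works for all large initial segments. A smaller bound would also
work for some large segment, contradicting leastness there. -/
theorem isLeast_of_eventually_const {f : ℕ → ℕ} {b c : ℕ} (h : ∀ n ≥ b, approxBound f n = c) :
    IsLeast {b | IsBound f b} c := by
  have hrep : ∀ n ≥ b, Repeats ((initialSegment f n).drop c) := fun n hn => by
    rw [← h n hn]; exact repeats_drop_leastBound _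
  have hbound : IsBound f c := fun x hx => by
    obtain ⟨y, hy, _, h'⟩ := repeats_drop_initialSegment.1
      (hrep (max b (x + 1)) (le_max_left _ _)) x hx
      (lt_max_of_lt_right (Nat.lt_succ_self x))
    exact ⟨y, hy, h'⟩
  refine ⟨hbound, fun d hd => ?_⟩
  by_contra! hdc
  choose! y hy hne he using hd
  -- The sum makes `n` exceed every partner `y x` with `x < c`. For larger `x` a partner below `n`
  -- comes from `hrep`.
  let n := b + c + (∑ x ∈ Finset.range c, y x) + 1
  refine hdc.not_ge ?_
  rw [← h n (by omega)]
  refine leastBound_le (repeats_drop_initialSegment.2 fun x hdx hxn => ?_)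
  by_cases hxc : x < c
  · have : y x ≤ ∑ x ∈ Finset.range c, y x :=
      Finset.single_le_sum (f := y) (fun _ _ => Nat.zero_le _) (Finset.mem_range.2 hxc)
    exact ⟨y x, hy x hdx, by omega, hne x hdx, he x hdx⟩
  · obtain ⟨z, hz, hzn, h'⟩ := repeats_drop_initialSegment.1 (hrep n (by omega)) x
      (not_lt.1 hxc) hxn
    exact ⟨z, hdc.le.trans hz, hzn, h'⟩

/-! ### Counting the changes of the approximation -/

/-- The number of changes of the approximate least bound, for a finite coloring that is given in
reverse order. -/
def changes : List ℕ → ℕ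
  | [] => 0
  | a :: l => if leastBound (a :: l).reverse = leastBound l.reverse then changes l
    else changes l + 1

/-- For a finite coloring that is given in reverse order, the number of changes if the last step is
a change, and `0` otherwise. -/
def label (l : List ℕ) : ℕ :=
  if leastBound l.reverse = leastBound l.tail.reverse then 0 else changes l

theorem changes_le_potential {f : ℕ → ℕ} {k : ℕ} (hf : ∀ n, f n < k) (n : ℕ) :
    changes (initialSegment f n).reverse ≤ potential k k (initialSegment f n) := by
  have hlt : ∀ n, ∀ a ∈ initialSegment f n, a < k := fun n a ha => by
    obtain ⟨i, _, rfl⟩ := List.mem_map.1 ha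
    exact hf i
  induction n with
  | zero => exact Nat.zero_le _
  | succ n ih =>
    have hl := hlt (n + 1)
    rw [initialSegment_succ] at hl ⊢
    rw [List.reverse_append, List.reverse_singleton, List.singleton_append, changes,
      List.reverse_cons, List.reverse_reverse]
    have := potential_append k hl (card_le_of_lt hl)
    split_ifs with h
    · rcases this with h' | ⟨h', _⟩ <;> omega
    · rcases this with h' | ⟨_, h'⟩
      · omega
      · exact (h h'.symm).elim

/-- The coloring that labels the changes of the approximate least bound for `f`. -/
def changeColoring (f : ℕ → ℕ) (n : ℕ) : ℕ := label (initialSegment f (n + 1)).reverse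

/-- The number of changes before stage `n`. -/
def changesBefore (f : ℕ → ℕ) (n : ℕ) : ℕ := changes (initialSegment f n).reverse

theorem changesBefore_succ (f : ℕ → ℕ) (n : ℕ) : changesBefore f (n + 1) =
    if approxBound f (n + 1) = approxBound f n then changesBefore f n
    else changesBefore f n + 1 := by
  simp [changesBefore, initialSegment_succ, changes, approxBound]

theorem changeColoring_eq (f : ℕ → ℕ) (n : ℕ) : changeColoring f n =
    if approxBound f (n + 1) = approxBound f n then 0 else changesBefore f n + 1 := by
  simp only [changeColoring, label, approxBound, List.reverse_reverse]
  rw [← changesBefore, changesBefore_succ]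
  simp only [approxBound, initialSegment_succ, List.reverse_append, List.reverse_singleton,
    List.singleton_append, List.tail_cons, List.reverse_reverse]
  split_ifs <;> rfl

theorem changesBefore_mono (f : ℕ → ℕ) : Monotone (changesBefore f) :=
  monotone_nat_of_le_succ fun n => by rw [changesBefore_succ]; split_ifs <;> omega

theorem changesBefore_lt {f : ℕ → ℕ} {k : ℕ} (hf : ∀ n, f n < k) (n : ℕ) :
    changesBefore f n < (2 * k + 1) ^ k :=
  (changes_le_potential hf n).trans_lt (potential_lt k fun a ha => by
    obtain ⟨i, _, rfl⟩ := List.mem_map.1 ha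
    exact hf i)

theorem changeColoring_lt {f : ℕ → ℕ} {k : ℕ} (hf : ∀ n, f n < k) (n : ℕ) :
    changeColoring f n < (2 * k + 1) ^ k + 1 := by
  have := changesBefore_lt hf n
  rw [changeColoring_eq]
  split_ifs <;> omega

/-- The monotone bounded count of changes attains its maximum, after which the color is constantly
0. This places the transformed instance in the domain of `ERT`. -/
theorem exists_isBound_changeColoring {f : ℕ → ℕ} {k : ℕ} (hf : ∀ n, f n < k) :
    ∃ b, IsBound (changeColoring f) b := by
  obtain ⟨b, hb⟩ : ∃ b, ∀ n, changesBefore f n ≤ changesBefore f b := by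
    obtain ⟨_, ⟨b, rfl⟩, hb⟩ := BddAbove.exists_isGreatest_of_nonempty
      ⟨_, Set.forall_mem_range.2 fun n => (changesBefore_lt hf n).le⟩
      (Set.range_nonempty (changesBefore f))
    exact ⟨b, fun n => hb ⟨n, rfl⟩⟩
  have hzero : ∀ x ≥ b, changeColoring f x = 0 := fun x hx => by
    rw [changeColoring_eq]
    refine if_pos (by_contra fun h => ?_)
    have h₁ := hb (x + 1)
    have h₂ := changesBefore_mono f hx
    rw [changesBefore_succ, if_neg h] at h₁
    omega
  exact ⟨b, fun x hx => ⟨x + 1, by omega, by omega, by rw [hzero x hx, hzero (x + 1) (by omega)]⟩⟩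

/-- The approximation does not change after a bound for the coloring of the changes. -/
theorem approxBound_eq_of_isBound {f : ℕ → ℕ} {b : ℕ} (hb : IsBound (changeColoring f) b) :
    ∀ n ≥ b, approxBound f n = approxBound f b := by
  intro n hn
  induction n, hn using Nat.le_induction with
  | base => rfl
  | succ n hn ih =>
    rw [← ih]
    by_contra hne
    obtain ⟨y, -, hny, e⟩ := hb n hn
    -- The count strictly increases past a change, so two changes at different stages carry
    -- different labels.
    have key : ∀ m n, m < n → approxBound f (m + 1) ≠ approxBound f m →
        changesBefore f m < changesBefore f n := fun m n hmn h => by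
      have := changesBefore_mono f (Nat.succ_le_of_lt hmn)
      rw [Nat.succ_eq_add_one, changesBefore_succ, if_neg h] at this
      exact this
    rw [changeColoring_eq, if_neg hne, changeColoring_eq] at e
    split_ifs at e with hy
    rcases lt_or_gt_of_ne hny with h | h
    · have := key n y h hne; omega
    · have := key y n h hy; omega

end Weihrauch

namespace Weihrauch

open Encodable

/-! ### Computability -/

namespace ComputableFunctional

/-- Partial computable functions, regarded as functionals that ignore the oracle. -/
theorem of_partrec {f : ℕ →. ℕ} (hf : Nat.Partrec f) : ComputableFunctional fun _ => f := by
  induction hf with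
  | zero => exact .zero
  | succ => exact .succ
  | left => exact .left
  | right => exact .right
  | pair _ _ hf hg => exact hf.pair hg
  | comp _ _ hf hg => exact hf.comp hg
  | prec _ _ hf hg => exact hf.prec hg
  | rfind _ hf => exact hf.rfind

/-- The total functional `Φ` is computable. -/
def Total (Φ : (ℕ → ℕ) → ℕ → ℕ) : Prop := ComputableFunctional fun p n => Part.some (Φ p n)

theorem total_oracle : Total fun p n => p n := .oracle

theorem Total.comp {Φ Ψ : (ℕ → ℕ) → ℕ → ℕ} (hΦ : Total Φ) (hΨ : Total Ψ) :
    Total fun p n => Φ p (Ψ p n) := by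
  have := ComputableFunctional.comp hΦ hΨ
  simpa [Total] using this

theorem Total.pair {Φ Ψ : (ℕ → ℕ) → ℕ → ℕ} (hΦ : Total Φ) (hΨ : Total Ψ) :
    Total fun p n => Nat.pair (Φ p n) (Ψ p n) := by
  have := ComputableFunctional.pair hΦ hΨ
  simpa [Total, Seq.seq] using this

theorem total_of_primrec {f : ℕ → ℕ} (hf : Nat.Primrec f) : Total fun _ => f :=
  of_partrec (Nat.Partrec.of_primrec hf)

theorem Total.prec {Φ Ψ : (ℕ → ℕ) → ℕ → ℕ} (hΦ : Total Φ) (hΨ : Total Ψ) :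
    Total fun p a => a.unpair.2.rec (Φ p a.unpair.1) fun y i =>
      Ψ p (Nat.pair a.unpair.1 (Nat.pair y i)) := by
  have := ComputableFunctional.prec hΦ hΨ
  refine (congrArg ComputableFunctional (funext₂ fun p a => ?_)).mp this
  dsimp only
  induction a.unpair.2 with
  | zero => rfl
  | succ y ih => exact (congrArg (· >>= _) ih).trans (Part.bind_some _ _)

/-- The values of the oracle at the first `n` positive arguments can be computed from `n`. -/
theorem total_encode_initialSegment :
    Total fun p n => encode (initialSegment (fun i => p (i + 1)) n).reverse := by
  have hy : Nat.Primrec fun a => a.unpair.2.unpair.1 + 1 :=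
    Nat.Primrec.succ.comp (Nat.Primrec.left.comp Nat.Primrec.right)
  have hi : Nat.Primrec fun a => a.unpair.2.unpair.2 := Nat.Primrec.right.comp Nat.Primrec.right
  -- A nonempty list is encoded as the successor of the pair of head and tail. Prepending the newest
  -- value is one such step, which is why segments are kept in reverse order.
  have hstep := (total_of_primrec .succ).comp
    ((total_oracle.comp (total_of_primrec hy)).pair (total_of_primrec hi))
  have hpair : Nat.Primrec fun n => Nat.pair 0 n := Nat.Primrec.zero.pair Nat.Primrec.id
  have := ((total_of_primrec .zero).prec hstep).comp (total_of_primrec hpair)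
  convert this using 3 with p n
  simp only [Nat.unpair_pair]
  induction n with
  | zero => rfl
  | succ n ih => rw [initialSegment_succ, List.reverse_append]; simp [ih]

/-- The values of a primitive recursive function at codes of the initial segments of the oracle. -/
theorem total_of_primrec_list {F : ℕ → List ℕ → ℕ} (hF : Primrec₂ F) :
    Total fun p n => F (p 0) (initialSegment (fun i => p (i + 1)) n).reverse := by
  have h₀ : Total fun p _ => p 0 := total_oracle.comp (total_of_primrec .zero)
  have hF' : Nat.Primrec fun c => encode ((decode (α := ℕ × List ℕ) c).map fun q => F q.1 q.2) :=
    hF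
  -- `Nat.pred` strips the successor that encodes `some`.
  have := (total_of_primrec .pred).comp
    ((total_of_primrec hF').comp (h₀.pair total_encode_initialSegment))
  convert this using 3 with p n
  rw [show Nat.pair (p 0) (encode (initialSegment (fun i => p (i + 1)) n).reverse) =
    encode (p 0, (initialSegment (fun i => p (i + 1)) n).reverse) from rfl, encodek]
  simp

end ComputableFunctional

/-! ### Primitive recursiveness of the finite approximations -/

theorem primrec_count : Primrec₂ fun (l : List ℕ) a => l.count a := by
  have := Primrec.list_length.comp₂ (PrimrecRel.listFilter (R := fun a b : ℕ => a = b) Primrec.eq)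
  refine this.of_eq fun l a => ?_
  rw [List.count_eq_length_filter]
  rfl

theorem primrecPred_repeats : PrimrecPred Repeats := by
  have h : PrimrecRel fun (a : ℕ) (l : List ℕ) => 2 ≤ l.count a :=
    Primrec.nat_le.comp (.const 2) (primrec_count.comp .snd .fst)
  exact (h.forall_mem_list).comp .id .id

theorem primrec_leastBound : Primrec leastBound := by
  have := Primrec.list_rec (f := fun l : List ℕ => l) (g := fun _ => 0)
    (h := fun _ q => if Repeats (q.1 :: q.2.1) then 0 else q.2.2 + 1) .id (.const 0)
    (Primrec.ite (primrecPred_repeats.comp (Primrec.list_cons.comp (Primrec.fst.comp .snd)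
      (Primrec.fst.comp (Primrec.snd.comp .snd)))) (.const 0)
      (Primrec.succ.comp (Primrec.snd.comp (Primrec.snd.comp .snd))))
  refine this.of_eq fun l => ?_
  induction l with
  | nil => rfl
  | cons a l ih => rw [leastBound, ← ih]

theorem primrec_changes : Primrec changes := by
  have := Primrec.list_rec (f := fun l : List ℕ => l) (g := fun _ => 0)
    (h := fun _ q => if leastBound (q.1 :: q.2.1).reverse = leastBound q.2.1.reverse then q.2.2
      else q.2.2 + 1) .id (.const 0)
    (Primrec.ite (Primrec.eq.comp
      (primrec_leastBound.comp (Primrec.list_reverse.comp (Primrec.list_cons.comp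
        (Primrec.fst.comp .snd) (Primrec.fst.comp (Primrec.snd.comp .snd)))))
      (primrec_leastBound.comp (Primrec.list_reverse.comp
        (Primrec.fst.comp (Primrec.snd.comp .snd)))))
      (Primrec.snd.comp (Primrec.snd.comp .snd))
      (Primrec.succ.comp (Primrec.snd.comp (Primrec.snd.comp .snd))))
  refine this.of_eq fun l => ?_
  induction l with
  | nil => rfl
  | cons a l ih => rw [changes, ← ih]

theorem primrec_label : Primrec label :=
  Primrec.ite (Primrec.eq.comp (primrec_leastBound.comp Primrec.list_reverse)
    (primrec_leastBound.comp (Primrec.list_reverse.comp Primrec.list_tail))) (.const 0)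
    primrec_changes

/-- The instance of `ERT` for a pair `(k, f)`, at an argument `n`, from `k` and the first `n` values
of `f` in reverse order. -/
def changeInstance (k : ℕ) (l : List ℕ) : ℕ :=
  if l.length = 0 then (2 * k + 1) ^ k + 1 else label l

theorem primrec_changeInstance : Primrec₂ changeInstance := by
  have hpow : Primrec₂ fun m n : ℕ => m ^ n := Primrec₂.unpaired'.1 Nat.Primrec.pow
  exact Primrec.ite (Primrec.eq.comp (Primrec.list_length.comp .snd) (.const 0))
    (Primrec.succ.comp (hpow.comp (Primrec.nat_double_succ.comp .fst) .fst))
    (primrec_label.comp .snd)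

/-! ### The two Weihrauch reductions -/

theorem reducible_ERT_minERT : Reducible ERT minERT := by
  classical
  refine ⟨fun p n => Part.some (p n), fun _ n => Part.some n, .oracle,
    ComputableFunctional.total_of_primrec .id, ?_⟩
  rintro I ⟨b, hI, hb⟩
  have hex : ∃ b, IsBound (fun n => I (n + 1)) b := ⟨b, hb⟩
  -- The well-ordering of ℕ shows that `I` is in the domain of `minERT`; the reduction itself never
  -- computes this value.
  exact ⟨I, ⟨Nat.find hex, hI, Nat.find_spec hex, fun c hc => Nat.find_min' hex hc⟩,
    fun n => Part.mem_some _, fun S hS => ⟨S, Part.mem_some _, hS.1, hS.2.1⟩⟩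

/-- The forward map produces the coloring of the changes. The backward map reads `S` values of the
original coloring and returns their least bound, which is correct for every bound `S`, least or not.
-/
theorem reducible_minERT_ERT : Reducible minERT ERT := by
  refine ⟨_, _, ComputableFunctional.total_of_primrec_list primrec_changeInstance,
    ComputableFunctional.total_of_primrec_list (F := fun _ l => leastBound l.reverse)
      (primrec_leastBound.comp (Primrec.list_reverse.comp .snd)), ?_⟩
  rintro I ⟨_, hI, -⟩
  let J : ℕ → ℕ := fun n =>
    changeInstance (I 0) (initialSegment (fun i => I (i + 1)) n).reverse
  -- Argument 0 is reserved for the number of colors, so argument `n + 1` sees exactly the `n + 1`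
  -- values that determine the color of stage `n`.
  have hJ : ∀ n, J (n + 1) = changeColoring (fun i => I (i + 1)) n := fun n => by
    simp [J, changeInstance, changeColoring, initialSegment]
  have hJ₀ : J 0 = (2 * I 0 + 1) ^ I 0 + 1 := rfl
  have hJI : IsInstance J := fun n => by rw [hJ, hJ₀]; exact changeColoring_lt hI n
  have hJe : (fun n => J (n + 1)) = changeColoring fun i => I (i + 1) := funext hJ
  obtain ⟨b, hb⟩ := exists_isBound_changeColoring hI
  refine ⟨J, ⟨b, hJI, by rwa [← hJe] at hb⟩, fun n => Part.mem_some _, fun S hS => ?_⟩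
  refine ⟨_, Part.mem_some _, hI, ?_⟩
  have hS' : IsBound (changeColoring fun i => I (i + 1)) S := hJe ▸ hS.2
  simp only [List.reverse_reverse]
  exact isLeast_of_eventually_const (approxBound_eq_of_isBound hS')

end Weihrauch

theorem mainTheorem11 :
    Weihrauch.Equivalent Weihrauch.ERT Weihrauch.minERT ∧
      SecondOrder.Proves SecondOrder.RCA0Star
        (SecondOrder.Formula.iff SecondOrder.ERT SecondOrder.minERT) :=
  ⟨⟨Weihrauch.reducible_ERT_minERT, Weihrauch.reducible_minERT_ERT⟩,
    SecondOrder.proves_ERT_iff_minERT⟩
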